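/- Let $\mathfrak B$ be a complex Banach space. A closed densely defined operator $B$ in $\mathfrak B$ is called sectorial if there are $a\in\mathbb R$, $\varphi\in(0,\pi/2)$ and a constant $c$ such that the sector $S_{a,\varphi}=\{\lambda\in\mathbb C:\ \varphi\le|\arg(\lambda-a)|\le\pi\}$ lies in the resolvent set of $B$ and $\|(\lambda I-B)^{-1}\|\le \frac{c}{|\lambda-a|+1}$ for $\lambda\in S_{a,\varphi}$; it is called hyperbolic if moreover $\sigma(B)\cap i\mathbb R=\emptyset$. A $C_0$-semigroup $\{U(t)\}_{t\ge0}$ on $\mathfrak B$ is called hyperbolic with projection $P$ if $P$ is a bounded projection commuting with every $U(t)$, each $U(t)$ maps $\operatorname{Im}Q$ bijectively onto itself, where $Q=I-P$, and there are $N,\nu>0$ such that for all $x\in\mathfrak B$: $|U(t)Px|\le Ne^{-\nu t}|x|$ for $t\ge0$ and $|U_Q(t)x|\le Ne^{\nu t}|x|$ for $t<0$, where for $t<0$ the operator $U_Q(t)=[U(-t)Q]^{-1}$ is $Q$ followed by the inverse of $U(-t)|_{\operatorname{Im}Q}$. Its Green function is $G(t)=U(t)P$ for $t\ge0$ and $G(t)=-U_Q(t)$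 for $t<0$. **Lemma.** Let $\mathcal A$ be the infinitesimal generator of a $C_0$-semigroup $\{U(t)\}_{t\ge0}$ on $\mathfrak B$, and let $-\mathcal A$ be a hyperbolic sectorial operator. Then $\sigma_+(\mathcal A)=\{\lambda\in\sigma(\mathcal A):\operatorname{Re}\lambda>0\}$ and $\hat\sigma_-(\mathcal A)=(\sigma(\mathcal A)\cup\{\infty\})\setminus\sigma_+(\mathcal A)$ are spectral sets of $\mathcal A$ (open and closed in $\sigma(\mathcal A)\cup\{\infty\}$). Let $P_+$ and $P_-=I-P_+$ be the associated spectral (Riesz) projections, $\mathfrak B_\pm=P_\pm\mathfrak B$, and let $A_\pm=P_\pm\mathcal A$ be the operators in $\mathfrak B_\pm$ with domains $D(\mathcal A)\cap\mathfrak B_\pm$; then $A_+$ is everywhere defined and bounded on $\mathfrak B_+$, and $A_-$ generates a $C_0$-semigroup $\{e^{A_-t}\}_{t\ge0}$ on $\mathfrak B_-$. Moreover: 1. the semigroup $\{U(t)\}_{t\ge0}$ is hyperbolic, with projection $P_-$; 2. its Green function is $$G(t)=\begin{cases} e^{A_-t}P_-, & t\ge0,\\ -e^{A_+t}P_+, &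 t<0.\end{cases}$$ -/

import Mathlib

open Set Filter Topology

namespace HyperbolicSectorial

noncomputable section

/-! ### Spectrum of an unbounded operator -/

section Spectrum

variable {E : Type*} [NormedAddCommGroup E] [NormedSpace ℂ E]

/-- The bounded operator `R` is a two-sided inverse of `z I - A : D(A) → E`. -/
def IsResolventAt (A : E →ₗ.[ℂ] E) (z : ℂ) (R : E →L[ℂ] E) : Prop :=
  (∀ y : E, ∃ h : R y ∈ A.domain, z • R y - A ⟨R y, h⟩ = y) ∧
    ∀ x : A.domain, R (z • (x : E) - A x) = x

/-- The resolvent set of `A`. -/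
def resolventSet (A : E →ₗ.[ℂ] E) : Set ℂ :=
  {z | ∃ R : E →L[ℂ] E, IsResolventAt A z R}

/-- The spectrum of `A`. -/
def spectrum (A : E →ₗ.[ℂ] E) : Set ℂ := (resolventSet A)ᶜ

open Classical in
/-- The resolvent `(z I - A)⁻¹`, extended by `0` outside the resolvent set. -/
def resolvent (A : E →ₗ.[ℂ] E) (z : ℂ) : E →L[ℂ] E :=
  if h : ∃ R : E →L[ℂ] E, IsResolventAt A z R then h.choose else 0

/-- The extended spectrum `σ(A) ∪ {∞}`, a subset of the extended plane. -/
def extSpectrum (A : E →ₗ.[ℂ] E) : Set (OnePoint ℂ) :=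
  (fun z : ℂ => (z : OnePoint ℂ)) '' spectrum A ∪ {OnePoint.infty}

/-- Spectral sets: subsets of the extended spectrum that are open and closed in it. -/
def IsSpectralSet (A : E →ₗ.[ℂ] E) (S : Set (OnePoint ℂ)) : Prop :=
  S ⊆ extSpectrum A ∧ IsClopen ((Subtype.val : extSpectrum A → OnePoint ℂ) ⁻¹' S)

/-- The part of the spectrum in the open right half-plane. -/
def rightSpectrum (A : E →ₗ.[ℂ] E) : Set (OnePoint ℂ) :=
  (fun z : ℂ => (z : OnePoint ℂ)) '' {z ∈ spectrum A | 0 < z.re}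

/-- The rest of the extended spectrum; it contains `∞`. -/
def extLeftSpectrum (A : E →ₗ.[ℂ] E) : Set (OnePoint ℂ) :=
  extSpectrum A \ rightSpectrum A

end Spectrum

/-! ### Spectral projections -/

/-- The integral of `f` along the cycle formed by the curves `γ j : [0,1] → ℂ`. -/
def cycleIntegral {F : Type*} [NormedAddCommGroup F] [NormedSpace ℂ F] {n : ℕ}
    (γ : Fin n → ℝ → ℂ) (f : ℂ → F) : F :=
  ∑ j, ∫ t in (0 : ℝ)..1, deriv (γ j) t • f (γ j t)

/-- The winding number of the cycle `γ` around `z`. -/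
def cycleIndex {n : ℕ} (γ : Fin n → ℝ → ℂ) (z : ℂ) : ℂ :=
  (2 * Real.pi * Complex.I)⁻¹ * cycleIntegral γ (fun w => (w - z)⁻¹)

section Projection

variable {E : Type*} [NormedAddCommGroup E] [NormedSpace ℂ E]

/-- `P` is the spectral (Riesz) projection associated with the spectral set `S` of `A`, i.e. the
value `f(A) = f(∞) I + (2πi)⁻¹ ∫_γ f(z) (z I - A)⁻¹ dz` of the Dunford calculus at the function `f`
that is `1` near `S` and `0` near the rest of the extended spectrum. The value does not depend on
`γ`; expressed with a cycle `γ` of closed `C¹` curves in the resolvent set: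
* if `∞ ∉ S`, then `γ` winds once around the points of `S`, and not around the other
  points of the spectrum, and `P = (2πi)⁻¹ ∫_γ (z I - A)⁻¹ dz`;
* if `∞ ∈ S`, then `γ` has index `0` at the points of `S`, index `-1` at the other points of the
  spectrum, and `P = I + (2πi)⁻¹ ∫_γ (z I - A)⁻¹ dz`. -/
def IsSpectralProjection (A : E →ₗ.[ℂ] E) (S : Set (OnePoint ℂ)) (P : E →L[ℂ] E) : Prop :=
  IsSpectralSet A S ∧
    ∃ (n : ℕ) (γ : Fin n → ℝ → ℂ),
      (∀ j, ContDiff ℝ 1 (γ j) ∧ γ j 0 = γ j 1 ∧ ∀ t ∈ Icc (0 : ℝ) 1, γ j t ∈ resolventSet A) ∧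
      (∀ z ∈ spectrum A, cycleIndex γ z =
        S.indicator (fun _ => (1 : ℂ)) (z : OnePoint ℂ) -
          S.indicator (fun _ => (1 : ℂ)) OnePoint.infty) ∧
      P = S.indicator (fun _ => (1 : ℂ)) OnePoint.infty • (1 : E →L[ℂ] E) +
        (2 * Real.pi * Complex.I : ℂ)⁻¹ • cycleIntegral γ (resolvent A)

/-- The range of a bounded operator `P`. -/
abbrev ran (P : E →L[ℂ] E) : Submodule ℂ E := LinearMap.range (P : E →ₗ[ℂ] E)

/-- `P`, as an operator from `E` to its range. -/
abbrev toRan (P : E →L[ℂ] E) : E →ₗ[ℂ] ran P := LinearMap.rangeRestrict (P : E →ₗ[ℂ] E)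

/-- The operator `P A` on the range `X` of `P`, with domain `D(A) ∩ X`. -/
def part (A : E →ₗ.[ℂ] E) (P : E →L[ℂ] E) : ran P →ₗ.[ℂ] ran P where
  domain := A.domain.comap (ran P).subtype
  toFun :=
    { toFun := fun x => toRan P (A ⟨((x : ran P) : E), x.2⟩)
      map_add' := fun x y => by
        rw [← map_add, ← LinearPMap.map_add]
        rfl
      map_smul' := fun c x => by
        rw [RingHom.id_apply, ← map_smul, ← LinearPMap.map_smul]
        rfl }

end Projection

/-! ### Sectorial and hyperbolic operators -/

section Sectorial

variable {E : Type*} [NormedAddCommGroup E] [NormedSpace ℂ E]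

/-- The sector `φ ≤ |arg (z - a)| ≤ π`; the upper bound is automatic for the principal argument. -/
def sector (a φ : ℝ) : Set ℂ := {z | φ ≤ |Complex.arg (z - a)|}

/-- Sectorial operators. -/
def IsSectorial (A : E →ₗ.[ℂ] E) : Prop :=
  A.IsClosed ∧ Dense (A.domain : Set E) ∧
    ∃ a φ c : ℝ, 0 < φ ∧ φ < Real.pi / 2 ∧
      sector a φ ⊆ resolventSet A ∧
      ∀ z ∈ sector a φ, ‖resolvent A z‖ ≤ c / (‖z - a‖ + 1)

/-- Hyperbolic sectorial operators: the spectrum does not meet the imaginary axis. -/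
def IsHyperbolicSectorial (A : E →ₗ.[ℂ] E) : Prop :=
  IsSectorial A ∧ spectrum A ∩ {z | z.re = 0} = ∅

end Sectorial

/-! ### Semigroups

A one-parameter semigroup `(U(t))_{t ≥ 0}` is given by a family indexed by `ℝ` of which only the
members with `t ≥ 0` are used. -/

section Semigroup

variable {E : Type*} [NormedAddCommGroup E] [NormedSpace ℂ E]

/-- `(U(t))_{t ≥ 0}` is a `C₀`-semigroup of bounded operators. -/
def IsC0Semigroup (U : ℝ → E →L[ℂ] E) : Prop :=
  U 0 = 1 ∧ (∀ s t, 0 ≤ s → 0 ≤ t → U (s + t) = U s * U t) ∧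
    ∀ x, ContinuousOn (fun t => U t x) (Ici 0)

/-- `A` is the infinitesimal generator of `U`: `x ∈ D(A)` and `A x = y` exactly when
`(U(h) x - x) / h → y` as `h → 0+`. -/
def IsGenerator (U : ℝ → E →L[ℂ] E) (A : E →ₗ.[ℂ] E) : Prop :=
  ∀ x y : E, (x, y) ∈ A.graph ↔
    Tendsto (fun h : ℝ => h⁻¹ • (U h x - x)) (𝓝[>] 0) (𝓝 y)

/-- The exponential `e^{tB}` of a bounded operator, for every real `t`. -/
def opExp (B : E →L[ℂ] E) (t : ℝ) : E →L[ℂ] E := NormedSpace.exp (t • B)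

/-- For `t < 0`, with `Q = I - P`: the operator `U_Q(t) = [U(-t) Q]⁻¹`, that is, the inverse of
`U(-t) : Im Q → Im Q`, applied to `Q x`. -/
def backward (U : ℝ → E →L[ℂ] E) (P : E →L[ℂ] E) (t : ℝ) (x : E) : E :=
  Function.invFunOn (U (-t)) (ran (1 - P) : Set E) ((1 - P) x)

/-- The semigroup `U` is hyperbolic, with projection `P`. -/
def IsHyperbolicWith (U : ℝ → E →L[ℂ] E) (P : E →L[ℂ] E) : Prop :=
  P * P = P ∧
    (∀ t, 0 ≤ t → U t * P = P * U t) ∧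
    (∀ t, 0 ≤ t → BijOn (U t) (ran (1 - P) : Set E) (ran (1 - P) : Set E)) ∧
    ∃ N ν : ℝ, 0 < N ∧ 0 < ν ∧
      (∀ t x, 0 ≤ t → ‖U t (P x)‖ ≤ N * Real.exp (-ν * t) * ‖x‖) ∧
      ∀ t x, t < 0 → ‖backward U P t x‖ ≤ N * Real.exp (ν * t) * ‖x‖

/-- The Green function of a semigroup that is hyperbolic with projection `P`. -/
def greenFunction (U : ℝ → E →L[ℂ] E) (P : E →L[ℂ] E) (t : ℝ) (x : E) : E :=
  if 0 ≤ t then U t (P x) else -backward U P t x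

end Semigroup

end

end HyperbolicSectorial

namespace HyperbolicSectorial

/-! ### Growth of degenerate semigroups with a decaying resolvent -/

section Growth

open MeasureTheory

variable {E : Type*} [NormedAddCommGroup E]

/-! Sectoriality bounds the spectrum of `A` in Re z ≥ 0 and hyperbolicity keeps it off the imaginary
axis, so the part in Re z > 0 is compact and a circle in the open right half-plane, contained in the
resolvent set, encloses it. Let P be the Riesz projection of this circle and Q = I - P; both commute
with the semigroup. On ran P the generator is the bounded operator (2πi)⁻¹ ∮ z (zI - A)⁻¹ dz, so
U(t) is an exponential there (`apply_eq_ranExp`); it is invertible, and its inverse gives the Green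
function at negative times.

What remains is the exponential decay of U(t)Q and of e^{-tA₊}P as t → ∞. Both are cases of
`IsResolventFamily.exists_norm_le_exp_neg`, whose input is a resolvent bound C / (1 + |z|) on Re z >
0. For U(t)Q the bound holds because (zI - A)⁻¹Q extends holomorphically over the disc
(`complResolvent`); for e^{-tA₊}P the resolvent is a Cauchy integral over the circle, evaluated at
-z, far from the circle.

Decay follows from such a bound by Fourier inversion: if ‖T(t)‖ ≤ K e^{ωt} with ω ≥ 0, then t ‖T(t)‖
≤ πC² e^{ω't} for every ω' > ω, with a constant independent of K and ω. At a time b depending only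
on C this lowers the exponent by 1/b, and finitely many repetitions make it negative. No
representation of the semigroup by a contour integral is needed. -/

theorem integrableOn_Ioi_of_norm_le_exp {g : ℝ → E} (hg : ContinuousOn g (Ici 0)) {K η : ℝ}
    (hη : 0 < η) (h : ∀ t, 0 ≤ t → ‖g t‖ ≤ K * Real.exp (-η * t)) :
    IntegrableOn g (Ioi 0) := by
  refine Integrable.mono' ((exp_neg_integrableOn_Ioi 0 hη).const_mul K)
    ((hg.mono Ioi_subset_Ici_self).aestronglyMeasurable measurableSet_Ioi) ?_
  filter_upwards [ae_restrict_mem measurableSet_Ioi] with t ht using h t (le_of_lt ht)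

theorem tendsto_zero_of_norm_le_exp {g : ℝ → E} {K η : ℝ}
    (hη : 0 < η) (h : ∀ t, 0 ≤ t → ‖g t‖ ≤ K * Real.exp (-η * t)) :
    Tendsto g atTop (𝓝 0) := by
  have h1 : Tendsto (fun t : ℝ => K * Real.exp (-η * t)) atTop (𝓝 0) := by
    have : Tendsto (fun t : ℝ => -η * t) atTop atBot :=
      tendsto_id.const_mul_atTop_of_neg (by linarith)
    simpa using (Real.tendsto_exp_atBot.comp this).const_mul K
  refine squeeze_zero_norm' ?_ h1
  filter_upwards [eventually_ge_atTop 0] with t ht using h t ht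

variable [NormedSpace ℂ E]

theorem exists_norm_le_on_Icc [CompleteSpace E] {T : ℝ → E →L[ℂ] E}
    (hcont : ∀ x, ContinuousOn (fun t => T t x) (Ici 0)) (b : ℝ) :
    ∃ K, 0 < K ∧ ∀ t ∈ Icc 0 b, ‖T t‖ ≤ K := by
  obtain ⟨K, hK⟩ := banach_steinhaus (g := fun t : Icc (0 : ℝ) b => T t) (fun x => by
    obtain ⟨C, hC⟩ := isCompact_Icc.exists_bound_of_continuousOn
      ((hcont x).mono (Icc_subset_Ici_self : Icc 0 b ⊆ Ici 0))
    exact ⟨C, fun t => hC t t.2⟩)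
  exact ⟨max K 1, by positivity, fun t ht => (hK ⟨t, ht⟩).trans (le_max_left _ _)⟩

/-- Write t = s + nb with 0 ≤ s < b, so that T(t) = T(s) T(b)ⁿ, where T(s) is bounded uniformly on
[0, b]. The exponent θ may have either sign. -/
theorem exists_norm_le_exp_of_norm_le [CompleteSpace E] {T : ℝ → E →L[ℂ] E}
    (hmul : ∀ s t, 0 ≤ s → 0 ≤ t → T (s + t) = T s * T t)
    (hcont : ∀ x, ContinuousOn (fun t => T t x) (Ici 0)) {b θ : ℝ} (hb : 0 < b)
    (h : ‖T b‖ ≤ Real.exp (θ * b)) :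
    ∃ K, 0 < K ∧ ∀ t, 0 ≤ t → ‖T t‖ ≤ K * Real.exp (θ * t) := by
  obtain ⟨K, hK0, hK⟩ := exists_norm_le_on_Icc hcont b
  have key : ∀ (n : ℕ) (s : ℝ), s ∈ Icc 0 b → ‖T (s + n * b)‖ ≤ K * Real.exp (θ * b) ^ n := by
    intro n s hs
    induction n with
    | zero => simpa using hK s hs
    | succ n ih =>
      have h1 : T (s + (n + 1 : ℕ) * b) = T (s + n * b) * T b := by
        rw [← hmul _ _ (add_nonneg hs.1 (by positivity)) hb.le]
        push_cast; ring_nf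
      rw [h1, pow_succ, ← mul_assoc]
      exact (norm_mul_le _ _).trans (mul_le_mul ih h (norm_nonneg _) (by positivity))
  -- The factor e^{|θ|b} pays for replacing nb by t in the exponent when θ is negative.
  refine ⟨K * Real.exp (|θ| * b), by positivity, fun t ht => ?_⟩
  set n := ⌊t / b⌋₊
  have h1 : (n : ℝ) * b ≤ t := (le_div_iff₀ hb).1 (Nat.floor_le (by positivity))
  have h2 : t < (n + 1) * b := (div_lt_iff₀ hb).1 (Nat.lt_floor_add_one _)
  have hs : t - n * b ∈ Icc 0 b := ⟨by linarith, by linarith⟩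
  have h3 := key n _ hs
  rw [sub_add_cancel, ← Real.exp_nat_mul] at h3
  refine h3.trans ?_
  rw [mul_assoc, ← Real.exp_add]
  gcongr
  have h4 : -θ * (t - n * b) ≤ |θ| * b :=
    mul_le_mul (neg_le_abs θ) hs.2 hs.1 (abs_nonneg _)
  linarith

/-- A derivative formula at `0` for orbits propagates to right derivatives at all times. -/
theorem hasDerivWithinAt_orbit {T : ℝ → E →L[ℂ] E}
    (hmul : ∀ s t, 0 ≤ s → 0 ≤ t → T (s + t) = T s * T t) {x y : E}
    (h : HasDerivWithinAt (fun s => T s x) y (Ici 0) 0) {t : ℝ} (ht : 0 ≤ t) :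
    HasDerivWithinAt (fun s => T s x) (T t y) (Ici t) t := by
  have h1 : HasDerivWithinAt (fun s => s - t) 1 (Ici t) t :=
    ((hasDerivAt_id t).sub_const t).hasDerivWithinAt
  have h2 : HasDerivWithinAt (fun s => T s x) y (Ici 0) (t - t) := by simpa using h
  have h3 := HasDerivWithinAt.scomp (h := fun s => s - t) t h2 h1
    (fun s hs => sub_nonneg.2 (mem_Ici.1 hs))
  have h4 := (T t).restrictScalars ℝ |>.hasFDerivAt.comp_hasDerivWithinAt t h3
  rw [one_smul] at h4
  refine h4.congr (fun s hs => ?_) ?_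
  · have : T s = T t * T (s - t) := by
      rw [← hmul _ _ ht (by simpa using hs)]; simp
    simp [this]
  · have : T t = T t * T 0 := by rw [← hmul _ _ ht le_rfl]; simp
    conv_lhs => rw [this]
    simp

/-- The generator controls only right derivatives of orbits, hence this form of the fundamental
theorem of calculus. -/
theorem integral_Ioi_eq_neg_of_hasDerivWithinAt_right [CompleteSpace E] {u v : ℝ → E}
    (hu : ContinuousOn u (Ici 0)) (hv : ContinuousOn v (Ici 0))
    (hd : ∀ t, 0 ≤ t → HasDerivWithinAt u (v t) (Ici t) t) (hint : IntegrableOn v (Ioi 0))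
    (hlim : Tendsto u atTop (𝓝 0)) : ∫ t in Ioi 0, v t = -u 0 := by
  have h1 := intervalIntegral_tendsto_integral_Ioi 0 hint tendsto_id
  have h2 : Tendsto (fun b => u b - u 0) atTop (𝓝 (0 - u 0)) := hlim.sub_const _
  rw [zero_sub] at h2
  refine tendsto_nhds_unique h1 (h2.congr' ?_)
  filter_upwards [eventually_ge_atTop 0] with b hb
  refine (intervalIntegral.integral_eq_sub_of_hasDeriv_right_of_le hb
    (hu.mono Icc_subset_Ici_self)
    (fun t ht => (hd t ht.1.le).mono Ioi_subset_Ici_self) ?_).symm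
  exact (hv.mono (by rw [uIcc_of_le hb]; exact Icc_subset_Ici_self)).intervalIntegrable

/-- A one-parameter semigroup `T`, possibly degenerate at `0`, together with operators `R z`
which play the role of the resolvent of its generator on the range of `T 0`, in the open right
half-plane. -/
structure IsResolventFamily (T : ℝ → E →L[ℂ] E) (R : ℂ → E →L[ℂ] E) : Prop where
  map_add : ∀ s t, 0 ≤ s → 0 ≤ t → T (s + t) = T s * T t
  continuousOn : ∀ x, ContinuousOn (fun t => T t x) (Ici 0)
  zero_mul : ∀ z, 0 < z.re → T 0 * R z = R z
  hasDerivWithinAt : ∀ z y, 0 < z.re →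
    HasDerivWithinAt (fun h => T h (R z y)) (z • R z y - T 0 y) (Ici 0) 0

namespace IsResolventFamily

variable {T : ℝ → E →L[ℂ] E} {R : ℂ → E →L[ℂ] E}

theorem continuousOn_exp_smul (hT : IsResolventFamily T R) (z : ℂ) (x : E) :
    ContinuousOn (fun t : ℝ => Complex.exp (-z * t) • T t x) (Ici 0) :=
  (by fun_prop : Continuous fun t : ℝ => Complex.exp (-z * t)).continuousOn.smul
    (hT.continuousOn x)

theorem norm_exp_smul_le {K ω : ℝ} (hK : ∀ t, 0 ≤ t → ‖T t‖ ≤ K * Real.exp (ω * t)) (z : ℂ)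
    (x : E) {t : ℝ} (ht : 0 ≤ t) :
    ‖Complex.exp (-z * t) • T t x‖ ≤ K * ‖x‖ * Real.exp (-(z.re - ω) * t) := by
  rw [norm_smul, Complex.norm_exp]
  have h1 : (-z * (t : ℂ)).re = -z.re * t := by simp
  rw [h1]
  calc Real.exp (-z.re * t) * ‖T t x‖
      ≤ Real.exp (-z.re * t) * (K * Real.exp (ω * t) * ‖x‖) := by
        gcongr; exact (T t).le_of_opNorm_le (hK t ht) x
    _ = K * ‖x‖ * (Real.exp (-z.re * t) * Real.exp (ω * t)) := by ring
    _ = _ := by rw [← Real.exp_add]; ring_nf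

theorem norm_smul_exp_smul_le {K ω : ℝ} (hK : ∀ t, 0 ≤ t → ‖T t‖ ≤ K * Real.exp (ω * t)) {z : ℂ}
    (hz : ω < z.re) (x : E) {t : ℝ} (ht : 0 ≤ t) :
    ‖t • Complex.exp (-z * t) • T t x‖ ≤
      (2 / (z.re - ω)) * (K * ‖x‖) * Real.exp (-((z.re - ω) / 2) * t) := by
  rw [norm_smul, Real.norm_of_nonneg ht]
  have h0 : 0 < z.re - ω := sub_pos.2 hz
  have hK0 : 0 ≤ K := by simpa using (norm_nonneg _).trans (hK 0 le_rfl)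
  -- Half of the decay rate absorbs the factor t, through 1 + u ≤ e^u.
  have h1 : t ≤ 2 / (z.re - ω) * Real.exp ((z.re - ω) / 2 * t) := by
    have := Real.add_one_le_exp ((z.re - ω) / 2 * t)
    rw [div_mul_eq_mul_div, le_div_iff₀ h0]
    nlinarith
  calc t * ‖Complex.exp (-z * t) • T t x‖
      ≤ (2 / (z.re - ω) * Real.exp ((z.re - ω) / 2 * t)) *
          (K * ‖x‖ * Real.exp (-(z.re - ω) * t)) := by
        gcongr; exact norm_exp_smul_le hK z x ht
    _ = 2 / (z.re - ω) * (K * ‖x‖) *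
          (Real.exp ((z.re - ω) / 2 * t) * Real.exp (-(z.re - ω) * t)) := by ring
    _ = _ := by rw [← Real.exp_add]; ring_nf

theorem hasDerivWithinAt_exp_smul (hT : IsResolventFamily T R) {z : ℂ} (hz : 0 < z.re) (y : E)
    {t : ℝ} (ht : 0 ≤ t) :
    HasDerivWithinAt (fun s : ℝ => Complex.exp (-z * s) • T s (R z y))
      (-(Complex.exp (-z * t) • T t y)) (Ici t) t := by
  have h1 := hasDerivWithinAt_orbit hT.map_add (hT.hasDerivWithinAt z y hz) ht
  have h2 : HasDerivAt (fun s : ℝ => Complex.exp (-z * s)) (Complex.exp (-z * t) * -z) t := by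
    have : HasDerivAt (fun s : ℝ => -z * (s : ℂ)) (-z) t := by
      simpa using (Complex.ofRealCLM.hasDerivAt (x := t)).const_mul (-z)
    exact this.cexp
  have h3 : T t (T 0 y) = T t y := by
    rw [← mul_apply_eq_comp, ← hT.map_add t 0 ht le_rfl, add_zero]
  refine (h2.hasDerivWithinAt.smul h1).congr_deriv ?_
  rw [map_sub, map_smul, h3, smul_sub, mul_neg, neg_smul, mul_smul]
  abel

variable [CompleteSpace E]

/-- The integrand is minus the right derivative of e^{-zt} T(t) R(z)y, which tends to 0 at infinity
and equals R(z)y at t = 0. -/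
theorem integral_exp_smul (hT : IsResolventFamily T R) {K ω : ℝ}
    (hK : ∀ t, 0 ≤ t → ‖T t‖ ≤ K * Real.exp (ω * t)) {z : ℂ} (hz : 0 < z.re) (hω : ω < z.re)
    (y : E) : ∫ t : ℝ in Ioi 0, Complex.exp (-z * t) • T t y = R z y := by
  have h0 : 0 < z.re - ω := sub_pos.2 hω
  have hc := hT.continuousOn_exp_smul z y
  have h := integral_Ioi_eq_neg_of_hasDerivWithinAt_right
    (hT.continuousOn_exp_smul z (R z y)) hc.neg
    (fun t ht => hT.hasDerivWithinAt_exp_smul hz y ht)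
    (integrableOn_Ioi_of_norm_le_exp hc h0 fun t ht => norm_exp_smul_le hK z y ht).neg
    (tendsto_zero_of_norm_le_exp h0 fun t ht => norm_exp_smul_le hK z _ ht)
  have h1 : T 0 (R z y) = R z y := by
    rw [← mul_apply_eq_comp, hT.zero_mul z hz]
  simp only [Pi.neg_apply] at h
  rw [integral_neg] at h
  simpa [h1] using h

/-- The function t e^{-zt} T(t) R(z)y vanishes at 0 and at infinity, so its derivative e^{-zt} T(t)
R(z)y - t e^{-zt} T(t)y has integral 0; the first term integrates to R(z)²y. The square is what
makes the transform integrable on vertical lines. -/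
theorem integral_smul_exp_smul (hT : IsResolventFamily T R) {K ω : ℝ}
    (hK : ∀ t, 0 ≤ t → ‖T t‖ ≤ K * Real.exp (ω * t)) {z : ℂ} (hz : 0 < z.re) (hω : ω < z.re)
    (y : E) : ∫ t : ℝ in Ioi 0, t • Complex.exp (-z * t) • T t y = R z (R z y) := by
  have h0 : 0 < z.re - ω := sub_pos.2 hω
  have hc := hT.continuousOn_exp_smul z (R z y)
  have hct : ∀ x, ContinuousOn (fun t : ℝ => t • Complex.exp (-z * t) • T t x) (Ici 0) :=
    fun x => continuousOn_id.smul (hT.continuousOn_exp_smul z x)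
  have hi1 := integrableOn_Ioi_of_norm_le_exp hc h0 fun t ht => norm_exp_smul_le hK z _ ht
  have hi2 := integrableOn_Ioi_of_norm_le_exp (hct y) (half_pos h0)
    fun t ht => norm_smul_exp_smul_le hK hω y ht
  have h := integral_Ioi_eq_neg_of_hasDerivWithinAt_right (hct (R z y)) (hc.sub (hct y))
    (fun t ht => by
      refine ((hasDerivAt_id t).hasDerivWithinAt.smul
        (hT.hasDerivWithinAt_exp_smul hz y ht)).congr_deriv ?_
      simp only [Pi.sub_apply, id_eq, one_smul, smul_neg]
      abel)
    (hi1.sub hi2)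
    (tendsto_zero_of_norm_le_exp (half_pos h0) fun t ht => norm_smul_exp_smul_le hK hω _ ht)
  simp only [Pi.sub_apply] at h
  rw [integral_sub hi1 hi2, hT.integral_exp_smul hK hz hω] at h
  exact (sub_eq_zero.1 (by simpa using h)).symm

/-- Fourier inversion of `R(ω + is)²`, as an estimate. -/
theorem mul_norm_le (hT : IsResolventFamily T R) {K ω ω' C : ℝ}
    (hK : ∀ t, 0 ≤ t → ‖T t‖ ≤ K * Real.exp (ω * t)) (hω0 : 0 ≤ ω) (hω : ω < ω')
    (hC : ∀ z, 0 < z.re → ‖R z‖ ≤ C / (1 + ‖z‖)) {t : ℝ} (ht : 0 ≤ t) :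
    t * ‖T t‖ ≤ C ^ 2 * Real.pi * Real.exp (ω' * t) := by
  have hω' : 0 < ω' := hω0.trans_lt hω
  have hC0 : 0 ≤ C := by
    have h := (norm_nonneg _).trans (hC 1 (by simp))
    simp only [norm_one] at h
    linarith
  have main : ∀ y, ‖t • Complex.exp (-ω' * t) • T t y‖ ≤ C ^ 2 * Real.pi * ‖y‖ := by
    intro y
    -- The line Re z = ω', parametrized to match the kernel e^{-2πist} of the Fourier transform.
    set z : ℝ → ℂ := fun s => ω' + 2 * Real.pi * s * Complex.I with hz
    have hzre : ∀ s, (z s).re = ω' := fun s => by simp [hz]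
    set g : ℝ → E := fun t => t • Complex.exp (-ω' * t) • T t y with hg
    -- Since g(0) = 0, this extension of g by zero is continuous, as pointwise inversion requires.
    set f : ℝ → E := fun t => g (max t 0) with hf
    have hgc : ContinuousOn g (Ici 0) := continuousOn_id.smul (hT.continuousOn_exp_smul ω' y)
    have hfc : Continuous f := hgc.comp_continuous (by fun_prop)
      (fun t => mem_Ici.2 (le_max_right _ _))
    have hf0 : ∀ t ∉ Ioi (0 : ℝ), f t = 0 := fun t ht => by
      simp only [mem_Ioi, not_lt] at ht
      simp [hf, hg, max_eq_right ht]
    have hf1 : ∀ t ∈ Ioi (0 : ℝ), f t = g t := fun t ht => by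
      simp only [mem_Ioi] at ht
      simp [hf, max_eq_left ht.le]
    have hgi : IntegrableOn g (Ioi 0) :=
      integrableOn_Ioi_of_norm_le_exp hgc (half_pos (sub_pos.2 (by simpa using hω)))
        fun t ht => norm_smul_exp_smul_le hK (z := ω') (by simpa using hω) y ht
    have hfi : Integrable f :=
      (integrableOn_iff_integrable_of_support_subset
        (fun t ht => by by_contra h; exact ht (hf0 t h))).1
        (hgi.congr_fun (fun t ht => (hf1 t ht).symm) measurableSet_Ioi)
    have hF : ∀ s, FourierTransform.fourier f s = R (z s) (R (z s) y) := by
      intro s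
      rw [Real.fourier_real_eq, ← hT.integral_smul_exp_smul hK (by rw [hzre]; exact hω')
        (by rw [hzre]; exact hω) y,
        ← setIntegral_eq_integral_of_forall_compl_eq_zero (s := Ioi 0)
          (fun t ht => by rw [hf0 t ht, smul_zero])]
      refine setIntegral_congr_fun measurableSet_Ioi fun t ht => ?_
      simp only [hf1 t ht, hg, Circle.smul_def, Real.fourierChar_apply]
      rw [smul_comm, smul_smul, ← Complex.exp_add]
      congr 3
      simp only [hz]
      push_cast
      ring
    have hRR : ∀ s, ‖R (z s) (R (z s) y)‖ ≤ C ^ 2 * ‖y‖ * (1 + s ^ 2)⁻¹ := by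
      intro s
      have hs : ‖R (z s)‖ ≤ C / (1 + ‖z s‖) := hC _ (by rw [hzre]; exact hω')
      have h1 : |s| ≤ ‖z s‖ := by
        have h2 := Complex.abs_im_le_norm (z s)
        have h3 : (z s).im = 2 * Real.pi * s := by simp [hz]
        rw [h3, abs_mul, abs_of_pos Real.two_pi_pos] at h2
        nlinarith [Real.pi_gt_three, abs_nonneg s]
      have h4 : 1 + s ^ 2 ≤ (1 + ‖z s‖) ^ 2 := by
        rw [← sq_abs s]; nlinarith [abs_nonneg s]
      calc ‖R (z s) (R (z s) y)‖ ≤ C / (1 + ‖z s‖) * (C / (1 + ‖z s‖) * ‖y‖) :=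
            (R (z s)).le_of_opNorm_le_of_le hs ((R (z s)).le_of_opNorm_le hs y)
        _ = C ^ 2 * ‖y‖ * ((1 + ‖z s‖) ^ 2)⁻¹ := by field_simp
        _ ≤ _ := by gcongr
    have hint : Integrable fun s : ℝ => C ^ 2 * ‖y‖ * (1 + s ^ 2)⁻¹ :=
      integrable_inv_one_add_sq.const_mul _
    have hFi : Integrable (FourierTransform.fourier f) := by
      refine hint.mono' ?_ (Eventually.of_forall fun s => by rw [hF]; exact hRR s)
      exact (VectorFourier.fourierIntegral_continuous Real.continuous_fourierChar
        (L := innerₗ ℝ) continuous_inner hfi).aestronglyMeasurable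
    have hinv := hfi.fourierInv_fourier_eq hFi (v := t) hfc.continuousAt
    have h5 : f t = t • Complex.exp (-ω' * t) • T t y := by simp [hf, hg, max_eq_left ht]
    rw [← h5, ← hinv, Real.fourierInv_eq]
    refine (norm_integral_le_of_norm_le hint (Eventually.of_forall fun s => ?_)).trans_eq ?_
    · rw [Circle.norm_smul, hF]
      exact hRR s
    · rw [integral_const_mul, integral_univ_inv_one_add_sq]
      ring
  have hexp : t * Real.exp (-ω' * t) * ‖T t‖ ≤ C ^ 2 * Real.pi := by
    have h1 : ‖(t * Real.exp (-ω' * t)) • T t‖ ≤ C ^ 2 * Real.pi := by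
      refine ContinuousLinearMap.opNorm_le_bound _ (by positivity) fun y => ?_
      refine le_of_eq_of_le ?_ (main y)
      simp only [smul_apply, norm_smul, Complex.norm_exp, norm_mul,
        Real.norm_eq_abs, Real.abs_exp, mul_assoc]
      simp
    rwa [norm_smul, Real.norm_of_nonneg (by positivity)] at h1
  have h2 : t * ‖T t‖ = t * Real.exp (-ω' * t) * ‖T t‖ * Real.exp (ω' * t) := by
    rw [neg_mul, Real.exp_neg]
    field_simp
  rw [h2]
  gcongr

/-- A semigroup whose generator has a resolvent that decays like `1 / (1 + |z|)` in the right
half-plane is exponentially stable. -/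
theorem exists_norm_le_exp_neg (hT : IsResolventFamily T R) {C : ℝ}
    (hC : ∀ z, 0 < z.re → ‖R z‖ ≤ C / (1 + ‖z‖)) :
    ∃ N ν : ℝ, 0 < N ∧ 0 < ν ∧ ∀ t, 0 ≤ t → ‖T t‖ ≤ N * Real.exp (-ν * t) := by
  set D : ℝ := C ^ 2 * Real.pi + 1 with hD
  have hD0 : 0 < D := by positivity
  -- With this b, the bound b ‖T(b)‖ ≤ D e^{ωb} reads ‖T(b)‖ ≤ e^{ωb - 1} = e^{(ω - 1/b)b}.
  set b : ℝ := D * Real.exp 1 with hb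
  have hb0 : 0 < b := by positivity
  have step : ∀ ω : ℝ, 0 ≤ ω → (∃ K, 0 < K ∧ ∀ t, 0 ≤ t → ‖T t‖ ≤ K * Real.exp (ω * t)) →
      ∃ K, 0 < K ∧ ∀ t, 0 ≤ t → ‖T t‖ ≤ K * Real.exp ((ω - 1 / b) * t) := by
    rintro ω hω ⟨K, -, hK⟩
    refine exists_norm_le_exp_of_norm_le hT.map_add hT.continuousOn hb0 ?_
    have h1 : b * ‖T b‖ ≤ D * Real.exp (ω * b) := by
      have hlim : Tendsto (fun ω' => D * Real.exp (ω' * b)) (𝓝[>] ω)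
          (𝓝 (D * Real.exp (ω * b))) :=
        ((by fun_prop : Continuous fun ω' => D * Real.exp (ω' * b)).tendsto ω).mono_left
          nhdsWithin_le_nhds
      refine ge_of_tendsto hlim ?_
      filter_upwards [self_mem_nhdsWithin] with ω' hω'
      refine (hT.mul_norm_le hK hω hω' hC hb0.le).trans ?_
      gcongr
      linarith
    have h2 : (ω - 1 / b) * b = ω * b - 1 := by field_simp
    rw [h2, Real.exp_sub, le_div_iff₀ (Real.exp_pos 1)]
    rw [hb, mul_assoc] at h1
    rw [mul_comm, hb]
    exact le_of_mul_le_mul_left h1 hD0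
  obtain ⟨ω, hω, h0⟩ : ∃ ω : ℝ, 0 ≤ ω ∧
      ∃ K, 0 < K ∧ ∀ t, 0 ≤ t → ‖T t‖ ≤ K * Real.exp (ω * t) := by
    refine ⟨Real.log (max ‖T 1‖ 1), Real.log_nonneg (le_max_right _ _),
      exists_norm_le_exp_of_norm_le hT.map_add hT.continuousOn one_pos ?_⟩
    rw [mul_one, Real.exp_log (by positivity)]
    exact le_max_left _ _
  -- The improvement step needs a nonnegative exponent, since R is controlled only on Re z > 0; once
  -- the exponent is negative the iteration stops.
  have iter : ∀ n : ℕ, ∃ θ : ℝ, (θ < 0 ∨ θ = ω - n * (1 / b)) ∧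
      ∃ K, 0 < K ∧ ∀ t, 0 ≤ t → ‖T t‖ ≤ K * Real.exp (θ * t) := by
    intro n
    induction n with
    | zero => exact ⟨ω, by simp, h0⟩
    | succ n ih =>
      obtain ⟨θ, hθ, hK⟩ := ih
      rcases lt_or_ge θ 0 with hneg | hpos
      · exact ⟨θ, Or.inl hneg, hK⟩
      · refine ⟨θ - 1 / b, Or.inr ?_, step θ hpos hK⟩
        rw [hθ.resolve_left hpos.not_gt]
        push_cast
        ring
  obtain ⟨n, hn⟩ := exists_nat_gt (ω * b)
  obtain ⟨θ, hθ, K, hK0, hK⟩ := iter n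
  have hneg : θ < 0 := by
    rcases hθ with h | h
    · exact h
    · rw [h, sub_neg, mul_one_div, lt_div_iff₀ hb0]
      exact hn
  exact ⟨K, -θ, hK0, by linarith, fun t ht => by simpa using hK t ht⟩

end IsResolventFamily

end Growth

/-! ### Resolvents -/

section Resolvent

variable {E : Type*} [NormedAddCommGroup E] [NormedSpace ℂ E]
variable {A : E →ₗ.[ℂ] E} {z w : ℂ} {R S : E →L[ℂ] E}

theorem IsResolventAt.eq (hR : IsResolventAt A z R) (hS : IsResolventAt A z S) : R = S := by
  ext y
  obtain ⟨h, e⟩ := hS.1 y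
  have h1 := hR.2 ⟨S y, h⟩
  rwa [e] at h1

theorem IsResolventAt.exists_apply_eq (hR : IsResolventAt A z R) (y : E) :
    ∃ h : R y ∈ A.domain, A ⟨R y, h⟩ = z • R y - y := by
  obtain ⟨h, e⟩ := hR.1 y
  exact ⟨h, eq_sub_of_add_eq' (sub_eq_iff_eq_add.1 e).symm⟩

theorem isResolventAt_resolvent (hz : z ∈ resolventSet A) :
    IsResolventAt A z (resolvent A z) := by
  have h : ∃ R : E →L[ℂ] E, IsResolventAt A z R := hz
  rw [resolvent, dif_pos h]
  exact h.choose_spec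

theorem IsResolventAt.resolvent_eq (hR : IsResolventAt A z R) : resolvent A z = R :=
  (isResolventAt_resolvent ⟨R, hR⟩).eq hR

/-- The resolvent identity. -/
theorem resolvent_eq_mul_one_add (hz : z ∈ resolventSet A) (hw : w ∈ resolventSet A) :
    resolvent A w = resolvent A z * (1 + (z - w) • resolvent A w) := by
  ext y
  obtain ⟨h, e⟩ := (isResolventAt_resolvent hw).exists_apply_eq y
  have h1 := (isResolventAt_resolvent hz).2 ⟨_, h⟩
  have h2 : z • resolvent A w y - A ⟨resolvent A w y, h⟩ = y + (z - w) • resolvent A w y := by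
    rw [e, sub_smul]
    abel
  simp only [h2] at h1
  simpa using h1.symm

theorem commute_resolvent (hz : z ∈ resolventSet A) (hw : w ∈ resolventSet A) :
    Commute (resolvent A z) (resolvent A w) := by
  rcases eq_or_ne z w with rfl | hne
  · exact Commute.refl _
  have h1 := resolvent_eq_mul_one_add hz hw
  have h2 := resolvent_eq_mul_one_add hw hz
  rw [mul_add, mul_one, mul_smul_comm, ← sub_eq_iff_eq_add'] at h1 h2
  have h3 : (z - w) • (resolvent A z * resolvent A w) =
      (z - w) • (resolvent A w * resolvent A z) := by
    rw [← h1, ← neg_sub w z, neg_smul, ← h2, neg_sub]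
  exact smul_right_injective _ (sub_ne_zero.2 hne) h3

/-- On D(A), wI - A = (I + (w - z)R)(zI - A). -/
theorem IsResolventAt.mul_inv (hz : IsResolventAt A z R) (u : (E →L[ℂ] E)ˣ)
    (hu : (u : E →L[ℂ] E) = 1 + (w - z) • R) : IsResolventAt A w (R * ↑u⁻¹) := by
  have hc : Commute R u := by
    rw [hu]
    exact (Commute.one_right R).add_right ((Commute.refl R).smul_right _)
  have hc' : R * ↑u⁻¹ = ↑u⁻¹ * R := (hc.units_inv_right).eq
  constructor
  · intro y
    obtain ⟨h, e⟩ := hz.exists_apply_eq ((↑u⁻¹ : E →L[ℂ] E) y)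
    refine ⟨h, ?_⟩
    have h1 : (u : E →L[ℂ] E) ((↑u⁻¹ : E →L[ℂ] E) y) = y := by
      rw [← mul_apply_eq_comp, Units.mul_inv]; rfl
    rw [hu] at h1
    have h2 : A ⟨(R * ↑u⁻¹) y, h⟩ = A ⟨R ((↑u⁻¹ : E →L[ℂ] E) y), h⟩ := rfl
    rw [h2, e]
    conv_rhs => rw [← h1]
    simp [sub_smul]
    abel
  · intro x
    rw [hc', mul_apply_eq_comp]
    have h1 : R (w • (x : E) - A x) = (u : E →L[ℂ] E) x := by
      have h2 : w • (x : E) - A x = (z • (x : E) - A x) + (w - z) • (x : E) := by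
        rw [sub_smul]; abel
      rw [h2, map_add, hz.2 x, hu]
      simp
    rw [h1, ← mul_apply_eq_comp, Units.inv_mul]; rfl

variable [CompleteSpace E]

theorem eventually_resolvent_eq (hz : z ∈ resolventSet A) :
    ∀ᶠ w in 𝓝 z, w ∈ resolventSet A ∧
      resolvent A w = resolvent A z * Ring.inverse (1 + (w - z) • resolvent A z) := by
  have hc : Continuous fun w : ℂ => 1 + (w - z) • resolvent A z := by fun_prop
  have h1 : {x : E →L[ℂ] E | IsUnit x} ∈ 𝓝 (1 + (z - z) • resolvent A z) := by
    simpa using Units.isOpen.mem_nhds (isUnit_one : IsUnit (1 : E →L[ℂ] E))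
  filter_upwards [hc.continuousAt.preimage_mem_nhds h1] with w hw
  obtain ⟨u, hu⟩ := hw
  have h2 := (isResolventAt_resolvent hz).mul_inv u hu
  refine ⟨⟨_, h2⟩, ?_⟩
  rw [h2.resolvent_eq, ← Ring.inverse_unit, hu]

theorem isOpen_resolventSet (A : E →ₗ.[ℂ] E) : IsOpen (resolventSet A) :=
  isOpen_iff_mem_nhds.2 fun _ hz => (eventually_resolvent_eq hz).mono fun _ h => h.1

theorem differentiableAt_resolvent (hz : z ∈ resolventSet A) :
    DifferentiableAt ℂ (resolvent A) z := by
  have h1 : DifferentiableAt ℂ (fun w : ℂ => 1 + (w - z) • resolvent A z) z := by fun_prop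
  have h2 : DifferentiableAt ℂ (Ring.inverse : (E →L[ℂ] E) → _) (1 + (z - z) • resolvent A z) :=
    differentiableAt_inverse (by simp)
  exact ((h2.fun_comp' z h1).const_mul _).congr_of_eventuallyEq
    ((eventually_resolvent_eq hz).mono fun _ h => h.2)

end Resolvent

/-! ### Integrals of the resolvent along a circle -/

section Dunford

variable {E : Type*} [NormedAddCommGroup E] [NormedSpace ℂ E]

/-- The operator `(2πi)⁻¹ ∮ g(z) (z I - A)⁻¹ dz`, the integral being along a circle. -/
noncomputable def dunford (A : E →ₗ.[ℂ] E) (c : ℂ) (r : ℝ) (g : ℂ → ℂ) : E →L[ℂ] E :=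
  (2 * Real.pi * Complex.I : ℂ)⁻¹ • ∮ z in C(c, r), g z • resolvent A z

/-- The mean `(2πi)⁻¹ ∮ g(z) dz` along a circle. -/
noncomputable def circleMean (c : ℂ) (r : ℝ) (g : ℂ → ℂ) : ℂ :=
  (2 * Real.pi * Complex.I : ℂ)⁻¹ * ∮ z in C(c, r), g z

theorem _root_.ContinuousLinearMap.circleIntegral_comp_comm {F G : Type*} [NormedAddCommGroup F]
    [NormedSpace ℂ F] [CompleteSpace F] [NormedAddCommGroup G] [NormedSpace ℂ G]
    [CompleteSpace G] (L : F →L[ℂ] G) {f : ℂ → F} {c : ℂ} {r : ℝ} (hf : CircleIntegrable f c r) :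
    ∮ z in C(c, r), L (f z) = L (∮ z in C(c, r), f z) := by
  simp only [circleIntegral, ← L.map_smul]
  exact L.intervalIntegral_comp_comm hf.out

variable {A : E →ₗ.[ℂ] E} {c : ℂ} {r : ℝ} {g h : ℂ → ℂ}

theorem dunford_congr (hr : 0 ≤ r) (hgh : EqOn g h (Metric.sphere c r)) :
    dunford A c r g = dunford A c r h := by
  rw [dunford, dunford, circleIntegral.integral_congr hr fun z hz => by rw [hgh hz]]

theorem dunford_const_mul (a : ℂ) (g : ℂ → ℂ) :
    dunford A c r (fun z => a * g z) = a • dunford A c r g := by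
  simp only [dunford, mul_smul]
  rw [circleIntegral.integral_smul, smul_comm]

variable [CompleteSpace E]

theorem continuousOn_resolvent_sphere (hs : Metric.sphere c r ⊆ resolventSet A) :
    ContinuousOn (resolvent A) (Metric.sphere c r) := fun _ hz =>
  (differentiableAt_resolvent (hs hz)).continuousAt.continuousWithinAt

theorem circleIntegrable_smul_resolvent (hr : 0 ≤ r) (hs : Metric.sphere c r ⊆ resolventSet A)
    (hg : ContinuousOn g (Metric.sphere c r)) :
    CircleIntegrable (fun z => g z • resolvent A z) c r :=
  (hg.smul (continuousOn_resolvent_sphere hs)).circleIntegrable hr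

theorem dunford_add (hr : 0 ≤ r) (hs : Metric.sphere c r ⊆ resolventSet A)
    (hg : ContinuousOn g (Metric.sphere c r)) (hh : ContinuousOn h (Metric.sphere c r)) :
    dunford A c r (fun z => g z + h z) = dunford A c r g + dunford A c r h := by
  simp only [dunford, add_smul]
  rw [circleIntegral.integral_add (circleIntegrable_smul_resolvent hr hs hg)
    (circleIntegrable_smul_resolvent hr hs hh), smul_add]

theorem commute_dunford (hr : 0 ≤ r) (hs : Metric.sphere c r ⊆ resolventSet A)
    (hg : ContinuousOn g (Metric.sphere c r)) {K : E →L[ℂ] E}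
    (hK : ∀ z ∈ Metric.sphere c r, Commute K (resolvent A z)) :
    Commute K (dunford A c r g) := by
  have hi := circleIntegrable_smul_resolvent hr hs hg
  have h1 := (ContinuousLinearMap.mul ℂ (E →L[ℂ] E) K).circleIntegral_comp_comm hi
  have h2 := ((ContinuousLinearMap.mul ℂ (E →L[ℂ] E)).flip K).circleIntegral_comp_comm hi
  simp only [ContinuousLinearMap.mul_apply', ContinuousLinearMap.flip_apply] at h1 h2
  have h3 : ∮ z in C(c, r), K * (g z • resolvent A z) =
      ∮ z in C(c, r), (g z • resolvent A z) * K :=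
    circleIntegral.integral_congr hr fun z hz => by
      simp only [mul_smul_comm, smul_mul_assoc, (hK z hz).eq]
  rw [dunford, commute_iff_eq, mul_smul_comm, smul_mul_assoc, ← h1, ← h2, h3]

/-- Pulling a fixed resolvent out of the integral shows that the range lies in D(A), without moving
the unbounded operator under the integral sign. -/
theorem dunford_eq_resolvent_mul (hr : 0 ≤ r) (hs : Metric.sphere c r ⊆ resolventSet A)
    (hg : ContinuousOn g (Metric.sphere c r)) {μ : ℂ} (hμ : μ ∈ resolventSet A) :
    dunford A c r g = resolvent A μ *
      (circleMean c r g • (1 : E →L[ℂ] E) + dunford A c r (fun z => (μ - z) * g z)) := by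
  have hi1 : CircleIntegrable (fun z => g z • (1 : E →L[ℂ] E)) c r :=
    (hg.smul continuousOn_const).circleIntegrable hr
  have hi2 : CircleIntegrable (fun z => ((μ - z) * g z) • resolvent A z) c r :=
    circleIntegrable_smul_resolvent hr hs
      ((by fun_prop : Continuous fun z => μ - z).continuousOn.mul hg)
  have h1 := (ContinuousLinearMap.mul ℂ (E →L[ℂ] E) (resolvent A μ)).circleIntegral_comp_comm
    (hi1.add hi2)
  simp only [ContinuousLinearMap.mul_apply', Pi.add_apply] at h1
  have h2 : ∮ z in C(c, r), g z • resolvent A z = ∮ z in C(c, r),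
      resolvent A μ * (g z • 1 + ((μ - z) * g z) • resolvent A z) :=
    circleIntegral.integral_congr hr fun z hz => by
      conv_lhs => rw [resolvent_eq_mul_one_add hμ (hs hz)]
      simp only [mul_add, smul_add, mul_smul_comm, smul_smul, mul_comm (g z)]
  rw [dunford, h2, h1, circleIntegral.integral_add hi1 hi2, circleIntegral.integral_smul_const,
    ← mul_smul_comm, smul_add, smul_smul]
  rfl

/-- This is A(zI - A)⁻¹ = z(zI - A)⁻¹ - I, integrated against g. -/
theorem exists_apply_dunford (hr : 0 ≤ r) (hs : Metric.sphere c r ⊆ resolventSet A)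
    (hg : ContinuousOn g (Metric.sphere c r)) (x : E) :
    ∃ hx : dunford A c r g x ∈ A.domain,
      A ⟨dunford A c r g x, hx⟩ = dunford A c r (fun z => z * g z) x - circleMean c r g • x := by
  obtain ⟨μ, hμs⟩ : (Metric.sphere c r).Nonempty := NormedSpace.sphere_nonempty.2 hr
  have hμ := hs hμs
  set k : E := circleMean c r g • x + dunford A c r (fun z => (μ - z) * g z) x with hk
  have h1 : dunford A c r g x = resolvent A μ k := by
    conv_lhs => rw [dunford_eq_resolvent_mul hr hs hg hμ]
    simp [hk]
  obtain ⟨h, e⟩ := (isResolventAt_resolvent hμ).exists_apply_eq k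
  refine ⟨h1 ▸ h, ?_⟩
  have h2 : A ⟨dunford A c r g x, h1 ▸ h⟩ = A ⟨resolvent A μ k, h⟩ := by
    congr 1; exact Subtype.ext h1
  have h3 : dunford A c r (fun z => (μ - z) * g z) =
      μ • dunford A c r g - dunford A c r (fun z => z * g z) := by
    rw [eq_sub_iff_add_eq, ← dunford_add (g := fun z => (μ - z) * g z) hr hs
      ((by fun_prop : Continuous fun z => μ - z).continuousOn.mul hg)
      (h := fun z => z * g z) (continuousOn_id.mul hg),
      ← dunford_const_mul]
    congr 1; ext z; ring
  rw [h2, e, ← h1, hk, h3]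
  simp only [sub_apply, smul_apply]
  abel

theorem circleMean_one : circleMean c r (fun _ => 1) = 0 := by
  have : ∮ _ in C(c, r), (1 : ℂ) = 0 := by
    have := circleIntegral.integral_sub_zpow_of_ne (n := 0) (by decide) c c r
    simpa using this
  rw [circleMean, this, mul_zero]

theorem circleMean_inv_of_mem_ball {w : ℂ} (hw : w ∈ Metric.ball c r) :
    circleMean c r (fun z => (z - w)⁻¹) = 1 := by
  rw [circleMean, circleIntegral.integral_sub_inv_of_mem_ball hw,
    inv_mul_cancel₀ Complex.two_pi_I_ne_zero]

theorem circleMean_inv_of_notMem_closedBall (hr : 0 ≤ r) {w : ℂ}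
    (hw : w ∉ Metric.closedBall c r) : circleMean c r (fun z => (z - w)⁻¹) = 0 := by
  have hne : ∀ z ∈ Metric.closedBall c r, z - w ≠ 0 := fun z hz h =>
    hw (sub_eq_zero.1 h ▸ hz)
  rw [circleMean, Complex.circleIntegral_eq_zero_of_differentiable_on_off_countable hr
    countable_empty, mul_zero]
  · exact ContinuousOn.inv₀ (by fun_prop) hne
  · exact fun z hz => DifferentiableAt.inv (by fun_prop) (hne z (Metric.ball_subset_closedBall hz.1))

theorem continuousOn_sub_inv {w : ℂ} {s : Set ℂ} (hw : w ∉ s) :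
    ContinuousOn (fun z => (z - w)⁻¹) s :=
  ContinuousOn.inv₀ (by fun_prop) fun _ hz h => hw (sub_eq_zero.1 h ▸ hz)

theorem exists_apply_dunford_one (hr : 0 ≤ r) (hs : Metric.sphere c r ⊆ resolventSet A) (x : E) :
    ∃ hx : dunford A c r (fun _ => 1) x ∈ A.domain,
      A ⟨dunford A c r (fun _ => 1) x, hx⟩ = dunford A c r (fun z => z) x := by
  simpa [circleMean_one] using exists_apply_dunford hr hs (g := fun _ => 1) continuousOn_const x

/-- `(2πi)⁻¹ ∮ (z - w)⁻¹ (z I - A)⁻¹ dz` inverts `w I - A` up to the Riesz projection. -/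
theorem exists_apply_dunford_inv (hr : 0 ≤ r) (hs : Metric.sphere c r ⊆ resolventSet A) {w : ℂ}
    (hw : w ∉ Metric.sphere c r) (x : E) :
    ∃ hx : dunford A c r (fun z => (z - w)⁻¹) x ∈ A.domain,
      w • dunford A c r (fun z => (z - w)⁻¹) x - A ⟨_, hx⟩ =
        circleMean c r (fun z => (z - w)⁻¹) • x - dunford A c r (fun _ => 1) x := by
  have hg := continuousOn_sub_inv hw
  obtain ⟨hx, e⟩ := exists_apply_dunford hr hs hg x
  refine ⟨hx, ?_⟩
  -- On the circle, z / (z - w) = 1 + w / (z - w).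
  have h1 : dunford A c r (fun z => z * (z - w)⁻¹) =
      dunford A c r (fun _ => 1) + w • dunford A c r (fun z => (z - w)⁻¹) := by
    rw [← dunford_const_mul, ← dunford_add hr hs continuousOn_const
      (h := fun z => w * (z - w)⁻¹) (continuousOn_const.mul hg)]
    refine dunford_congr hr fun z hz => ?_
    have : z - w ≠ 0 := fun h => hw (sub_eq_zero.1 h ▸ hz)
    field_simp
    ring
  rw [e, h1]
  simp only [add_apply, smul_apply]
  abel

end Dunford

/-! ### The Riesz projection of a circle -/

section Riesz

variable {E : Type*} [NormedAddCommGroup E] [NormedSpace ℂ E]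

/-- The Riesz projection of the part of the spectrum inside a circle. -/
noncomputable abbrev riesz (A : E →ₗ.[ℂ] E) (c : ℂ) (r : ℝ) : E →L[ℂ] E :=
  dunford A c r fun _ => 1

open Classical in
/-- The operator function `(z I - A)⁻¹ (I - P)`, where `P` is the Riesz projection of a circle,
extended over the inside of the circle. -/
noncomputable def complResolvent (A : E →ₗ.[ℂ] E) (c : ℂ) (r : ℝ) (z : ℂ) : E →L[ℂ] E :=
  if z ∈ Metric.ball c r then dunford A c r (fun w => (w - z)⁻¹)
  else resolvent A z * (1 - riesz A c r)

variable [CompleteSpace E] {A : E →ₗ.[ℂ] E} {c z : ℂ} {r : ℝ}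

theorem notMem_sphere_of_mem_ball (hz : z ∈ Metric.ball c r) : z ∉ Metric.sphere c r :=
  fun h => (Metric.mem_ball.1 hz).ne (Metric.mem_sphere.1 h)

theorem exists_apply_complResolvent (hr : 0 ≤ r) (hs : Metric.sphere c r ⊆ resolventSet A)
    (hz : z ∈ resolventSet A ∪ Metric.ball c r) (x : E) :
    ∃ hx : complResolvent A c r z x ∈ A.domain,
      A ⟨complResolvent A c r z x, hx⟩ =
        z • complResolvent A c r z x - (1 - riesz A c r) x := by
  by_cases hb : z ∈ Metric.ball c r
  · simp only [complResolvent, if_pos hb]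
    obtain ⟨hx, e⟩ := exists_apply_dunford_inv hr hs (notMem_sphere_of_mem_ball hb) x
    refine ⟨hx, ?_⟩
    rw [circleMean_inv_of_mem_ball hb, one_smul] at e
    rw [sub_apply, one_apply_eq_self, ← e, sub_sub_cancel]
  · simp only [complResolvent, if_neg hb]
    exact (isResolventAt_resolvent (hz.resolve_right hb)).exists_apply_eq _

/-- Both branches F(z) of the definition satisfy (zI - A)F(z) = I - P, which determines F(z)
wherever zI - A has a left inverse; hence they agree on the overlap. -/
theorem complResolvent_eq (hr : 0 ≤ r) (hs : Metric.sphere c r ⊆ resolventSet A)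
    (hz : z ∈ resolventSet A) :
    complResolvent A c r z = resolvent A z * (1 - riesz A c r) := by
  ext x
  obtain ⟨hx, e⟩ := exists_apply_complResolvent hr hs (Or.inl hz) x
  have h := (isResolventAt_resolvent hz).2 ⟨_, hx⟩
  rw [e, sub_sub_cancel] at h
  exact h.symm

/-- Inside the disc the function is a Cauchy integral of the resolvent; near a point of the
resolvent set it is (zI - A)⁻¹(I - P). -/
theorem differentiableAt_complResolvent (hr : 0 < r) (hs : Metric.sphere c r ⊆ resolventSet A)
    (hz : z ∈ resolventSet A ∪ Metric.ball c r) :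
    DifferentiableAt ℂ (complResolvent A c r) z := by
  rcases hz with hz | hz
  · refine ((differentiableAt_resolvent hz).mul_const (1 - riesz A c r)).congr_of_eventuallyEq ?_
    filter_upwards [(isOpen_resolventSet A).mem_nhds hz] with w hw
      using complResolvent_eq hr.le hs hw
  · have hi : CircleIntegrable (resolvent A) c r :=
      (continuousOn_resolvent_sphere hs).circleIntegrable hr.le
    lift r to NNReal using hr.le
    have h1 := (hasFPowerSeriesOn_cauchy_integral hi (by exact_mod_cast hr)).differentiableOn
    rw [Metric.eball_coe] at h1
    have hn := Metric.isOpen_ball.mem_nhds hz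
    refine (h1.differentiableAt hn).congr_of_eventuallyEq ?_
    filter_upwards [hn] with w hw
    rw [complResolvent, if_pos hw, dunford]

theorem commute_complResolvent (hr : 0 ≤ r) (hs : Metric.sphere c r ⊆ resolventSet A)
    (hz : z ∈ resolventSet A ∪ Metric.ball c r) {K : E →L[ℂ] E}
    (hK : ∀ z ∈ resolventSet A, Commute K (resolvent A z)) :
    Commute K (complResolvent A c r z) := by
  by_cases hb : z ∈ Metric.ball c r
  · rw [complResolvent, if_pos hb]
    exact commute_dunford hr hs (continuousOn_sub_inv (notMem_sphere_of_mem_ball hb))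
      fun w hw => hK w (hs hw)
  · rw [complResolvent, if_neg hb]
    exact (hK z (hz.resolve_right hb)).mul_right ((Commute.one_right K).sub_right
      (commute_dunford hr hs continuousOn_const fun w hw => hK w (hs hw)))

theorem commute_riesz_resolvent (hr : 0 ≤ r) (hs : Metric.sphere c r ⊆ resolventSet A)
    (hz : z ∈ resolventSet A) : Commute (riesz A c r) (resolvent A z) :=
  (commute_dunford hr hs continuousOn_const fun _ hw => commute_resolvent hz (hs hw)).symm

/-- The product is the integral of (zI - A)⁻¹(I - P) along the circle. This function extends
holomorphically over the disc, so Cauchy's theorem gives 0 without comparing two concentric circles.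
-/
theorem riesz_mul_one_sub (hr : 0 < r) (hs : Metric.sphere c r ⊆ resolventSet A) :
    riesz A c r * (1 - riesz A c r) = 0 := by
  have hi := circleIntegrable_smul_resolvent (A := A) (g := fun _ => 1) hr.le hs continuousOn_const
  have h1 := ((ContinuousLinearMap.mul ℂ (E →L[ℂ] E)).flip
    (1 - riesz A c r)).circleIntegral_comp_comm hi
  simp only [ContinuousLinearMap.mul_apply', ContinuousLinearMap.flip_apply] at h1
  have h2 : ∮ z in C(c, r), ((1 : ℂ) • resolvent A z) * (1 - riesz A c r) =
      ∮ z in C(c, r), complResolvent A c r z :=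
    circleIntegral.integral_congr hr.le fun z hz => by
      rw [one_smul, complResolvent_eq hr.le hs (hs hz)]
  have hd : ∀ z ∈ Metric.closedBall c r, DifferentiableAt ℂ (complResolvent A c r) z :=
    fun z hz => differentiableAt_complResolvent hr hs (by
      rw [← Metric.ball_union_sphere] at hz
      exact hz.symm.imp_left (@hs z))
  have h3 := Complex.circleIntegral_eq_zero_of_differentiable_on_off_countable hr.le
    countable_empty (fun z hz => (hd z hz).continuousAt.continuousWithinAt)
    (fun z hz => hd z (Metric.ball_subset_closedBall hz.1))
  rw [h2, h3] at h1
  conv_lhs => enter [1]; rw [riesz, dunford]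
  rw [smul_mul_assoc, ← h1, smul_zero]

theorem riesz_mul_self (hr : 0 < r) (hs : Metric.sphere c r ⊆ resolventSet A) :
    riesz A c r * riesz A c r = riesz A c r := by
  have h := riesz_mul_one_sub hr hs
  rw [mul_sub, mul_one, sub_eq_zero] at h
  exact h.symm

end Riesz

/-! ### Semigroups and their generators -/

section Generator

variable {E : Type*} [NormedAddCommGroup E] [NormedSpace ℂ E]
variable {A : E →ₗ.[ℂ] E} {U : ℝ → E →L[ℂ] E}

theorem IsGenerator.tendsto (hA : IsGenerator U A) (x : A.domain) :
    Tendsto (fun h : ℝ => h⁻¹ • (U h x - x)) (𝓝[>] 0) (𝓝 (A x)) :=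
  (hA x (A x)).1 (A.mem_graph x)

theorem IsGenerator.exists_of_tendsto (hA : IsGenerator U A) {x y : E}
    (h : Tendsto (fun h : ℝ => h⁻¹ • (U h x - x)) (𝓝[>] 0) (𝓝 y)) :
    ∃ hx : x ∈ A.domain, A ⟨x, hx⟩ = y := by
  obtain ⟨x', h1, h2⟩ := (LinearPMap.mem_graph_iff A).1 ((hA x y).2 h)
  subst h1
  exact ⟨x'.2, h2⟩

theorem IsGenerator.hasDerivWithinAt (hU : IsC0Semigroup U) (hA : IsGenerator U A)
    (x : A.domain) : HasDerivWithinAt (fun h => U h x) (A x) (Ici 0) 0 := by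
  rw [← hasDerivWithinAt_Ioi_iff_Ici, hasDerivWithinAt_iff_tendsto_slope' self_notMem_Ioi]
  refine (hA.tendsto x).congr fun h => ?_
  simp [slope, hU.1]

theorem IsGenerator.exists_apply_eq (hU : IsC0Semigroup U) (hA : IsGenerator U A)
    (x : A.domain) {t : ℝ} (ht : 0 ≤ t) : ∃ hx : U t x ∈ A.domain, A ⟨U t x, hx⟩ = U t (A x) := by
  refine hA.exists_of_tendsto ((((U t).continuous.tendsto _).comp (hA.tendsto x)).congr' ?_)
  filter_upwards [self_mem_nhdsWithin] with h hh
  have hh' : (0 : ℝ) ≤ h := le_of_lt hh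
  have h1 : U t (U h x) = U h (U t x) := by
    rw [← mul_apply_eq_comp, ← mul_apply_eq_comp, ← hU.2.1 t h ht hh', ← hU.2.1 h t hh' ht,
      add_comm]
  rw [Function.comp_apply, ContinuousLinearMap.map_smul_of_tower, map_sub, h1]

theorem IsGenerator.commute_resolvent (hU : IsC0Semigroup U) (hA : IsGenerator U A) {t : ℝ}
    (ht : 0 ≤ t) {z : ℂ} (hz : z ∈ resolventSet A) : Commute (U t) (resolvent A z) := by
  have hR := isResolventAt_resolvent hz
  ext y
  obtain ⟨h, e⟩ := hR.1 y
  obtain ⟨h', e'⟩ := hA.exists_apply_eq hU ⟨_, h⟩ ht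
  have h1 := hR.2 ⟨_, h'⟩
  rw [e', ← ContinuousLinearMap.map_smul, ← map_sub, e] at h1
  exact h1.symm

end Generator

/-! ### Sectorial operators -/

section Sector

variable {E : Type*} [NormedAddCommGroup E] [NormedSpace ℂ E] {A : E →ₗ.[ℂ] E}

theorem IsResolventAt.of_neg {z : ℂ} {R : E →L[ℂ] E} (h : IsResolventAt (-A) (-z) R) :
    IsResolventAt A z (-R) := by
  constructor
  · intro y
    obtain ⟨hy, e⟩ := h.1 y
    have hy' : R y ∈ A.domain := hy
    have h1 : (-A) ⟨R y, hy⟩ = -A ⟨R y, hy'⟩ := rfl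
    refine ⟨A.domain.neg_mem hy', ?_⟩
    have h2 : A ⟨(-R) y, A.domain.neg_mem hy'⟩ = -A ⟨R y, hy'⟩ := by
      rw [← LinearPMap.map_neg]; rfl
    rw [h2, neg_apply]
    rw [h1] at e
    conv_rhs => rw [← e]
    simp
  · intro x
    have h1 := h.2 x
    have h2 : (-A) x = -A x := rfl
    rw [h2] at h1
    rw [neg_apply, ← map_neg]
    convert h1 using 2
    simp
    abel

theorem mem_sector {a φ : ℝ} {z : ℂ} (hφ0 : 0 ≤ φ) (hφ : φ ≤ Real.pi) (hz : z ≠ a)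
    (h : (z - a).re ≤ ‖z - a‖ * Real.cos φ) : z ∈ sector a φ := by
  have h0 : 0 < ‖z - a‖ := norm_pos_iff.2 (sub_ne_zero.2 hz)
  rw [← Complex.norm_mul_cos_arg, ← Real.cos_abs] at h
  exact (Real.strictAntiOn_cos.le_iff_ge ⟨abs_nonneg _, Complex.abs_arg_le_pi _⟩ ⟨hφ0, hφ⟩).1
    (le_of_mul_le_mul_left h h0)

/-- If Re z ≥ 0, then -z - a has real part at most |a|, so for large |z| the point -z lies in the
sector. -/
theorem IsSectorial.exists_norm_resolvent_le (hs : IsSectorial (-A)) :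
    ∃ K C : ℝ, ∀ z : ℂ, 0 ≤ z.re → K ≤ ‖z‖ →
      z ∈ resolventSet A ∧ ‖resolvent A z‖ ≤ C / (1 + ‖z‖) := by
  obtain ⟨-, -, a, φ, c, hφ0, hφ, hsub, hb⟩ := hs
  have hcos : 0 < Real.cos φ := Real.cos_pos_of_mem_Ioo ⟨by linarith, hφ⟩
  -- The radius makes |-z - a| cos φ ≥ |a|; the factor 1 + |a| comes from 1 + |z| ≤ (1 + |a|)(1 +
  -- |-z - a|).
  refine ⟨|a| + |a| / Real.cos φ + 1, |c| * (1 + |a|), fun z hz hK => ?_⟩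
  have h1 : ‖z‖ ≤ ‖-z - a‖ + |a| := by
    have := norm_sub_le (-z - a) (-a : ℂ)
    simpa using this
  have h2 : |a| / Real.cos φ + 1 ≤ ‖-z - a‖ := by linarith
  have h3 : 0 < ‖-z - a‖ := lt_of_lt_of_le (by positivity) h2
  have hmem : -z ∈ sector a φ := by
    refine mem_sector hφ0.le (by linarith [Real.pi_pos]) (sub_ne_zero.1 (norm_pos_iff.1 h3)) ?_
    have h4 : |a| ≤ ‖-z - a‖ * Real.cos φ := (div_le_iff₀ hcos).1 (by linarith)
    have h5 : (-z - a : ℂ).re = -z.re - a := by simp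
    rw [h5]
    linarith [neg_abs_le a]
  have hR := isResolventAt_resolvent (hsub hmem)
  refine ⟨⟨_, hR.of_neg⟩, ?_⟩
  rw [hR.of_neg.resolvent_eq, norm_neg]
  refine (hb _ hmem).trans ?_
  calc c / (‖-z - a‖ + 1) ≤ |c| / (‖-z - a‖ + 1) := by gcongr; exact le_abs_self c
    _ ≤ _ := by
      rw [div_le_div_iff₀ (by positivity) (by positivity), mul_assoc]
      gcongr
      nlinarith [abs_nonneg a]

theorem IsHyperbolicSectorial.mem_resolventSet (hs : IsHyperbolicSectorial (-A)) {z : ℂ}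
    (hz : z.re = 0) : z ∈ resolventSet A := by
  have h : -z ∈ resolventSet (-A) := by
    by_contra h
    have : -z ∈ spectrum (-A) ∩ {z | z.re = 0} := ⟨h, by simp [hz]⟩
    rw [hs.2] at this
    exact this
  obtain ⟨R, hR⟩ := h
  exact ⟨-R, hR.of_neg⟩

variable [CompleteSpace E]

/-- Since the spectrum avoids the imaginary axis, the strict inequality can be relaxed to 0 ≤ Re z,
which gives closedness; boundedness comes from the sector. -/
theorem IsHyperbolicSectorial.isCompact_spectrum_inter (hs : IsHyperbolicSectorial (-A)) :
    IsCompact {z ∈ spectrum A | 0 < z.re} := by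
  obtain ⟨K, C, hK⟩ := hs.1.exists_norm_resolvent_le
  have h1 : {z ∈ spectrum A | 0 < z.re} = spectrum A ∩ {z | 0 ≤ z.re} := by
    ext z
    refine ⟨fun h => ⟨h.1, h.2.le⟩, fun h => ⟨h.1, lt_of_le_of_ne h.2 fun h0 => ?_⟩⟩
    exact h.1 (hs.mem_resolventSet h0.symm)
  rw [h1]
  refine (isCompact_closedBall (0 : ℂ) K).of_isClosed_subset
    ((isOpen_resolventSet A).isClosed_compl.inter
      (isClosed_le continuous_const Complex.continuous_re)) fun z hz => ?_
  rw [mem_closedBall_zero_iff]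
  by_contra! h
  exact hz.1 (hK z hz.2 h.le).1

/-- A compact subset of the open right half-plane lies inside a circle in this half-plane. -/
theorem _root_.IsCompact.exists_subset_ball_of_re_pos {s : Set ℂ} (hs : IsCompact s)
    (h : ∀ z ∈ s, 0 < z.re) : ∃ M r : ℝ, 0 < r ∧ r < M ∧ s ⊆ Metric.ball (M : ℂ) r := by
  obtain ⟨K, hK⟩ := hs.exists_bound_of_continuousOn continuousOn_id
  obtain ⟨ε, hε0, hε⟩ : ∃ ε : ℝ, 0 < ε ∧ ∀ z ∈ s, ε ≤ z.re := by
    rcases s.eq_empty_or_nonempty with rfl | hne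
    · exact ⟨1, one_pos, by simp⟩
    · obtain ⟨w, hw, hmin⟩ := hs.exists_isMinOn hne Complex.continuous_re.continuousOn
      exact ⟨w.re, h w hw, fun z hz => hmin hz⟩
  -- For this center M, M Re z ≥ Mε = K² + ε², and hence |z - M|² < (M - ε/2)² whenever |z| ≤ K.
  refine ⟨K ^ 2 / ε + ε, K ^ 2 / ε + ε / 2, by positivity, by linarith, fun z hz => ?_⟩
  set M : ℝ := K ^ 2 / ε + ε with hM
  have hMε : M * ε = K ^ 2 + ε ^ 2 := by rw [hM]; field_simp
  have hM0 : 0 ≤ M := by positivity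
  have hz1 : ‖z‖ ^ 2 ≤ K ^ 2 := by
    have := hK z hz
    simp only [id] at this
    gcongr
  have h1 : ‖z - M‖ ^ 2 = ‖z‖ ^ 2 - 2 * M * z.re + M ^ 2 := by
    rw [← Complex.normSq_eq_norm_sq, ← Complex.normSq_eq_norm_sq, Complex.normSq_apply,
      Complex.normSq_apply]
    simp
    ring
  rw [mem_ball_iff_norm]
  refine lt_of_pow_lt_pow_left₀ 2 (by positivity) ?_
  rw [h1, show K ^ 2 / ε + ε / 2 = M - ε / 2 by rw [hM]; ring]
  nlinarith [mul_le_mul_of_nonneg_left (hε z hz) hM0]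

theorem IsHyperbolicSectorial.exists_circle (hs : IsHyperbolicSectorial (-A)) :
    ∃ M r : ℝ, 0 < r ∧ r < M ∧ Metric.sphere (M : ℂ) r ⊆ resolventSet A ∧
      (∀ z ∈ spectrum A, 0 < z.re → z ∈ Metric.ball (M : ℂ) r) ∧
      ∀ z : ℂ, z.re ≤ 0 → z ∉ Metric.closedBall (M : ℂ) r := by
  obtain ⟨M, r, hr, hrM, hsub⟩ := hs.isCompact_spectrum_inter.exists_subset_ball_of_re_pos
    fun z hz => hz.2
  have hout : ∀ z : ℂ, z.re ≤ 0 → z ∉ Metric.closedBall (M : ℂ) r := fun z hz h => by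
    rw [mem_closedBall_iff_norm'] at h
    have h1 := (Complex.re_le_norm (M - z)).trans h
    simp at h1
    linarith
  refine ⟨M, r, hr, hrM, fun z hz => ?_, fun z hz h0 => hsub ⟨hz, h0⟩, hout⟩
  by_contra hn
  rcases lt_or_ge 0 z.re with h0 | h0
  · exact notMem_sphere_of_mem_ball (hsub ⟨hn, h0⟩) hz
  · exact hout z h0 (Metric.sphere_subset_closedBall hz)

end Sector

/-! ### Circles as cycles, and spectral sets -/

section Cycle

variable {F : Type*} [NormedAddCommGroup F] [NormedSpace ℂ F]

/-- The circle `C(c, r)` as a cycle. -/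
noncomputable def circleCycle (c : ℂ) (r : ℝ) : Fin 1 → ℝ → ℂ :=
  fun _ t => circleMap c r (2 * Real.pi * t)

/-- The circle `C(c, r)` as a cycle, run through in the negative direction. -/
noncomputable def revCircleCycle (c : ℂ) (r : ℝ) : Fin 1 → ℝ → ℂ :=
  fun _ t => circleMap c r (2 * Real.pi - 2 * Real.pi * t)

theorem cycleIntegral_circleCycle (c : ℂ) (r : ℝ) (f : ℂ → F) :
    cycleIntegral (circleCycle c r) f = ∮ z in C(c, r), f z := by
  have hd : ∀ (j : Fin 1) (t : ℝ), deriv (circleCycle c r j) t =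
      (2 * Real.pi) • deriv (circleMap c r) (2 * Real.pi * t) := fun _ t =>
    ((differentiable_circleMap c r _).hasDerivAt.scomp t
      (by simpa using (hasDerivAt_id t).const_mul (2 * Real.pi))).deriv
  simp only [cycleIntegral, Finset.univ_unique, Finset.sum_singleton, hd, circleIntegral,
    smul_assoc, intervalIntegral.integral_smul]
  simp only [circleCycle]
  rw [intervalIntegral.integral_comp_mul_left
    (fun t => deriv (circleMap c r) t • f (circleMap c r t)) Real.two_pi_pos.ne']
  simp only [mul_zero, mul_one]
  rw [smul_inv_smul₀ Real.two_pi_pos.ne']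

theorem cycleIntegral_revCircleCycle (c : ℂ) (r : ℝ) (f : ℂ → F) :
    cycleIntegral (revCircleCycle c r) f = -∮ z in C(c, r), f z := by
  have hd : ∀ (j : Fin 1) (t : ℝ), deriv (revCircleCycle c r j) t =
      (-(2 * Real.pi)) • deriv (circleMap c r) (2 * Real.pi - 2 * Real.pi * t) := fun _ t =>
    ((differentiable_circleMap c r _).hasDerivAt.scomp t
      (by simpa using ((hasDerivAt_id t).const_mul (2 * Real.pi)).const_sub (2 * Real.pi))).deriv
  simp only [cycleIntegral, Finset.univ_unique, Finset.sum_singleton, hd, circleIntegral,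
    smul_assoc, intervalIntegral.integral_smul]
  simp only [revCircleCycle]
  rw [intervalIntegral.integral_comp_sub_mul
    (fun t => deriv (circleMap c r) t • f (circleMap c r t)) Real.two_pi_pos.ne']
  simp only [mul_zero, mul_one, sub_zero, sub_self, neg_smul]
  rw [smul_inv_smul₀ Real.two_pi_pos.ne']

theorem circleCycle_isClosedC1 {s : Set ℂ} {c : ℂ} {r : ℝ} (hr : 0 ≤ r) (hs : Metric.sphere c r ⊆ s)
    (j : Fin 1) : ContDiff ℝ 1 (circleCycle c r j) ∧ circleCycle c r j 0 = circleCycle c r j 1 ∧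
      ∀ t ∈ Icc (0 : ℝ) 1, circleCycle c r j t ∈ s := by
  refine ⟨(contDiff_circleMap c r).comp (by fun_prop), ?_, fun t _ =>
    hs (circleMap_mem_sphere c hr _)⟩
  simp [circleCycle, circleMap]

theorem revCircleCycle_isClosedC1 {s : Set ℂ} {c : ℂ} {r : ℝ} (hr : 0 ≤ r) (hs : Metric.sphere c r ⊆ s)
    (j : Fin 1) : ContDiff ℝ 1 (revCircleCycle c r j) ∧
      revCircleCycle c r j 0 = revCircleCycle c r j 1 ∧
      ∀ t ∈ Icc (0 : ℝ) 1, revCircleCycle c r j t ∈ s := by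
  refine ⟨(contDiff_circleMap c r).comp (by fun_prop), ?_, fun t _ =>
    hs (circleMap_mem_sphere c hr _)⟩
  simp [revCircleCycle, circleMap]

end Cycle

/-! ### Spectral sets in the extended plane and their Riesz projections. -/

section SpectralSet

variable {E : Type*} [NormedAddCommGroup E] [NormedSpace ℂ E] {A : E →ₗ.[ℂ] E}

theorem coe_mem_rightSpectrum {z : ℂ} :
    (z : OnePoint ℂ) ∈ rightSpectrum A ↔ z ∈ spectrum A ∧ 0 < z.re := by
  simp [rightSpectrum]

theorem infty_notMem_rightSpectrum : OnePoint.infty ∉ rightSpectrum A := by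
  simp [rightSpectrum]

theorem coe_mem_extLeftSpectrum {z : ℂ} :
    (z : OnePoint ℂ) ∈ extLeftSpectrum A ↔ z ∈ spectrum A ∧ ¬ 0 < z.re := by
  simp only [extLeftSpectrum, Set.mem_sdiff, coe_mem_rightSpectrum, extSpectrum]
  simp
  tauto

theorem infty_mem_extLeftSpectrum : OnePoint.infty ∈ extLeftSpectrum A :=
  ⟨Or.inr rfl, infty_notMem_rightSpectrum⟩

/-- A compact set of the plane stays closed in the sphere, and the open half-plane, which cuts this
part out of the extended spectrum, stays open. -/
theorem isSpectralSet_rightSpectrum (h : IsCompact {z ∈ spectrum A | 0 < z.re}) :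
    IsSpectralSet A (rightSpectrum A) := by
  refine ⟨fun z hz => ?_, ?_, ?_⟩
  · obtain ⟨w, hw, rfl⟩ := hz
    exact Or.inl ⟨w, hw.1, rfl⟩
  · exact (OnePoint.isClosed_image_coe.2 ⟨h.isClosed, h⟩).preimage continuous_subtype_val
  · have ho : IsOpen ((fun z : ℂ => (z : OnePoint ℂ)) '' {z | 0 < z.re}) :=
      OnePoint.isOpen_image_coe.2 (isOpen_lt continuous_const Complex.continuous_re)
    convert ho.preimage (continuous_subtype_val (p := fun z => z ∈ extSpectrum A)) using 1
    ext ⟨z, hz⟩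
    rcases hz with ⟨w, hw, rfl⟩ | hz
    · simp [coe_mem_rightSpectrum, hw]
    · obtain rfl : z = OnePoint.infty := hz
      simp [infty_notMem_rightSpectrum]

theorem isSpectralSet_extLeftSpectrum (h : IsCompact {z ∈ spectrum A | 0 < z.re}) :
    IsSpectralSet A (extLeftSpectrum A) := by
  refine ⟨sdiff_subset, ?_⟩
  convert (isSpectralSet_rightSpectrum h).2.compl using 1
  ext z
  simp [extLeftSpectrum]

theorem isSpectralProjection_riesz (h : IsCompact {z ∈ spectrum A | 0 < z.re}) {c : ℂ} {r : ℝ}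
    (hr : 0 ≤ r) (hs : Metric.sphere c r ⊆ resolventSet A)
    (hin : ∀ z ∈ spectrum A, 0 < z.re → z ∈ Metric.ball c r)
    (hout : ∀ z : ℂ, z.re ≤ 0 → z ∉ Metric.closedBall c r) :
    IsSpectralProjection A (rightSpectrum A) (riesz A c r) := by
  refine ⟨isSpectralSet_rightSpectrum h, 1, circleCycle c r,
    circleCycle_isClosedC1 hr hs, fun z hz => ?_, ?_⟩
  · rw [indicator_of_notMem infty_notMem_rightSpectrum, sub_zero, cycleIndex,
      cycleIntegral_circleCycle]
    rcases lt_or_ge 0 z.re with h0 | h0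
    · rw [indicator_of_mem (coe_mem_rightSpectrum.2 ⟨hz, h0⟩)]
      exact circleMean_inv_of_mem_ball (hin z hz h0)
    · rw [indicator_of_notMem fun hn => h0.not_gt (coe_mem_rightSpectrum.1 hn).2]
      exact circleMean_inv_of_notMem_closedBall hr (hout z h0)
  · rw [indicator_of_notMem infty_notMem_rightSpectrum, zero_smul, zero_add,
      cycleIntegral_circleCycle]
    simp [dunford]

/-- The spectral set contains ∞, so the circle is reversed: its index is -1 on the right spectrum
and 0 on the rest, and its integral contributes -P. -/
theorem isSpectralProjection_one_sub_riesz (h : IsCompact {z ∈ spectrum A | 0 < z.re}) {c : ℂ}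
    {r : ℝ} (hr : 0 ≤ r) (hs : Metric.sphere c r ⊆ resolventSet A)
    (hin : ∀ z ∈ spectrum A, 0 < z.re → z ∈ Metric.ball c r)
    (hout : ∀ z : ℂ, z.re ≤ 0 → z ∉ Metric.closedBall c r) :
    IsSpectralProjection A (extLeftSpectrum A) (1 - riesz A c r) := by
  refine ⟨isSpectralSet_extLeftSpectrum h, 1, revCircleCycle c r, revCircleCycle_isClosedC1 hr hs,
    fun z hz => ?_, ?_⟩
  · rw [indicator_of_mem infty_mem_extLeftSpectrum, cycleIndex, cycleIntegral_revCircleCycle,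
      mul_neg]
    rcases lt_or_ge 0 z.re with h0 | h0
    · rw [indicator_of_notMem fun hn => (coe_mem_extLeftSpectrum.1 hn).2 h0, zero_sub]
      exact congrArg _ (circleMean_inv_of_mem_ball (hin z hz h0))
    · rw [indicator_of_mem (coe_mem_extLeftSpectrum.2 ⟨hz, h0.not_gt⟩), sub_self, neg_eq_zero]
      exact circleMean_inv_of_notMem_closedBall hr (hout z h0)
  · rw [indicator_of_mem infty_mem_extLeftSpectrum, one_smul, cycleIntegral_revCircleCycle]
    simp [dunford, sub_eq_add_neg]

end SpectralSet

/-! ### Resolvent bounds for the two spectral parts -/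

section Bounds

variable {E : Type*} [NormedAddCommGroup E] [NormedSpace ℂ E] [CompleteSpace E]
  {A : E →ₗ.[ℂ] E}

/-- Small z are handled by compactness, the function being continuous across the disc; large z by
the sectorial estimate. -/
theorem exists_norm_complResolvent_le (hs : IsSectorial (-A)) {c : ℂ} {r : ℝ} (hr : 0 < r)
    (hsph : Metric.sphere c r ⊆ resolventSet A)
    (hin : ∀ z ∈ spectrum A, 0 ≤ z.re → z ∈ Metric.ball c r) :
    ∃ C, ∀ z : ℂ, 0 < z.re → ‖complResolvent A c r z * (1 - riesz A c r)‖ ≤ C / (1 + ‖z‖) := by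
  obtain ⟨K, C, hK⟩ := hs.exists_norm_resolvent_le
  set Q := 1 - riesz A c r
  have hmem : ∀ z : ℂ, 0 ≤ z.re → z ∈ resolventSet A ∪ Metric.ball c r := fun z hz =>
    or_iff_not_imp_left.2 fun h => hin z h hz
  obtain ⟨C', hC'⟩ := ((isCompact_closedBall (0 : ℂ) K).inter_right
    (isClosed_le continuous_const Complex.continuous_re)).exists_bound_of_continuousOn
    (f := complResolvent A c r) (fun z hz =>
      (differentiableAt_complResolvent hr hsph (hmem z hz.2)).continuousAt.continuousWithinAt)
  refine ⟨max (C' * (1 + K)) (C * ‖Q‖) * ‖Q‖, fun z hz => ?_⟩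
  have hz0 : 0 < 1 + ‖z‖ := by positivity
  rw [mul_div_right_comm]
  refine (norm_mul_le _ _).trans (mul_le_mul_of_nonneg_right ?_ (norm_nonneg _))
  rw [le_div_iff₀ hz0]
  rcases le_or_gt ‖z‖ K with h | h
  · refine le_max_of_le_left ?_
    have h1 := hC' z ⟨mem_closedBall_zero_iff.2 h, hz.le⟩
    exact mul_le_mul h1 (by linarith) hz0.le ((norm_nonneg _).trans h1)
  · refine le_max_of_le_right ?_
    obtain ⟨h1, h2⟩ := hK z hz.le h.le
    rw [complResolvent_eq hr.le hsph h1]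
    rw [le_div_iff₀ hz0] at h2
    calc ‖resolvent A z * Q‖ * (1 + ‖z‖) ≤ ‖resolvent A z‖ * ‖Q‖ * (1 + ‖z‖) := by
          gcongr; exact norm_mul_le _ _
      _ = ‖resolvent A z‖ * (1 + ‖z‖) * ‖Q‖ := by ring
      _ ≤ _ := by gcongr

theorem exists_norm_dunford_inv_le {M r : ℝ} (hr : 0 ≤ r) (hrM : r < M)
    (hsph : Metric.sphere (M : ℂ) r ⊆ resolventSet A) :
    ∃ C, 0 ≤ C ∧ ∀ z : ℂ, 0 < z.re →
      ‖dunford A M r (fun w => (w - -z)⁻¹)‖ ≤ C / (1 + ‖z‖) := by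
  obtain ⟨L, hL⟩ := (isCompact_sphere (M : ℂ) r).exists_bound_of_continuousOn
    (continuousOn_resolvent_sphere hsph)
  have hL0 : 0 ≤ L := by
    obtain ⟨μ, hμ⟩ : (Metric.sphere (M : ℂ) r).Nonempty := NormedSpace.sphere_nonempty.2 hr
    exact (norm_nonneg _).trans (hL μ hμ)
  have hM : 0 < M := hr.trans_lt hrM
  have hMr : 0 < M - r := sub_pos.2 hrM
  refine ⟨r * ((1 + M) / (M - r) * L), by positivity, fun z hz => ?_⟩
  have hz0 : 0 < 1 + ‖z‖ := by positivity
  rw [mul_div_assoc]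
  refine circleIntegral.norm_two_pi_i_inv_smul_integral_le_of_norm_le_const hr fun w hw => ?_
  have h1 : M ≤ ‖z + M‖ := by
    have := Complex.re_le_norm (z + M)
    simp at this
    linarith
  have h2 : ‖z‖ ≤ ‖z + M‖ := by
    refine le_of_sq_le_sq ?_ (norm_nonneg _)
    rw [← Complex.normSq_eq_norm_sq, ← Complex.normSq_eq_norm_sq, Complex.normSq_apply,
      Complex.normSq_apply]
    simp
    nlinarith [mul_pos hz hM]
  have h3 : ‖z + M‖ - r ≤ ‖w - -z‖ := by
    rw [mem_sphere_iff_norm] at hw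
    have := norm_sub_le (w - -z) (w - M)
    rw [hw] at this
    have h4 : w - -z - (w - M) = z + M := by ring
    rw [h4] at this
    linarith
  -- Follows from |z + M| ≥ M and |z + M| ≥ |z|.
  have h5 : (M - r) / (1 + M) * (1 + ‖z‖) ≤ ‖w - -z‖ := by
    refine le_trans ?_ h3
    rw [div_mul_eq_mul_div, div_le_iff₀ (by positivity)]
    nlinarith [mul_le_mul_of_nonneg_left h2 hMr.le, mul_nonneg hr (sub_nonneg.2 h1)]
  have h6 : 0 < (M - r) / (1 + M) * (1 + ‖z‖) := by positivity
  rw [norm_smul, norm_inv]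
  calc ‖w - -z‖⁻¹ * ‖resolvent A w‖ ≤ ((M - r) / (1 + M) * (1 + ‖z‖))⁻¹ * L := by
        gcongr; exact hL w hw
    _ = _ := by field_simp

end Bounds

/-! ### Compressions to the range of a projection -/

section Compress

variable {E : Type*} [NormedAddCommGroup E] [NormedSpace ℂ E] {P K : E →L[ℂ] E}

theorem mem_ran_iff (hP : P * P = P) {x : E} : x ∈ ran P ↔ P x = x := by
  constructor
  · rintro ⟨y, rfl⟩
    exact DFunLike.congr_fun hP y
  · exact fun h => ⟨x, h⟩

theorem isClosed_ran (hP : P * P = P) : IsClosed (ran P : Set E) := by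
  have : (ran P : Set E) = {x | P x = x} := ext fun _ => mem_ran_iff hP
  rw [this]
  exact isClosed_eq P.continuous continuous_id

/-- The operator `P K` on the range of `P`. -/
noncomputable def compress (P K : E →L[ℂ] E) : ran P →L[ℂ] ran P :=
  (P ∘L K ∘L (ran P).subtypeL).codRestrict (ran P) fun _ => LinearMap.mem_range_self _ _

theorem coe_compress (hP : P * P = P) (hK : Commute K P) (y : ran P) :
    (compress P K y : E) = K y := by
  have h1 := DFunLike.congr_fun hK.eq (y : E)
  simp only [mul_apply_eq_comp, (mem_ran_iff hP).1 y.2] at h1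
  exact h1.symm

/-- The operator `e^{tB} P`, for an operator `B` on the range of `P`. -/
noncomputable def ranExp (P : E →L[ℂ] E) (B : ran P →L[ℂ] ran P) (t : ℝ) : E →L[ℂ] E :=
  (ran P).subtypeL ∘L opExp B t ∘L P.codRestrict (ran P) fun _ => LinearMap.mem_range_self _ _

variable {B : ran P →L[ℂ] ran P}

theorem ranExp_apply (t : ℝ) (x : E) : ranExp P B t x = opExp B t (toRan P x) := rfl

theorem toRan_coe (hP : P * P = P) (y : ran P) : toRan P y = y :=
  Subtype.ext ((mem_ran_iff hP).1 y.2)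

theorem opExp_zero : opExp B 0 = 1 := by simp [opExp]

theorem ranExp_zero (x : E) : ranExp P B 0 x = P x := by
  rw [ranExp_apply, opExp_zero]; rfl

variable [CompleteSpace (ran P)]

theorem opExp_add (s t : ℝ) : opExp B (s + t) = opExp B s * opExp B t := by
  rw [opExp, add_smul]
  let _ : NormedAlgebra ℚ (ran P →L[ℂ] ran P) := NormedAlgebra.restrictScalars ℚ ℂ _
  refine NormedSpace.exp_add_of_commute ?_
  ext y
  simp only [mul_apply_eq_comp, smul_apply, ContinuousLinearMap.map_smul_of_tower]
  rw [smul_comm]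

theorem ranExp_add (hP : P * P = P) (s t : ℝ) :
    ranExp P B (s + t) = ranExp P B s * ranExp P B t := by
  ext x
  rw [mul_apply_eq_comp, ranExp_apply, ranExp_apply, ranExp_apply, toRan_coe hP, opExp_add]
  rfl

theorem hasDerivAt_ranExp (t : ℝ) (x : E) :
    HasDerivAt (fun s => ranExp P B s x) (B (opExp B t (toRan P x)) : E) t := by
  have h1 : HasDerivAt (opExp B) (B * opExp B t) t := hasDerivAt_exp_smul_const' (𝕂 := ℝ) B t
  let L : (ran P →L[ℂ] ran P) →L[ℂ] E :=
    (ran P).subtypeL ∘L ContinuousLinearMap.apply ℂ (ran P) (toRan P x)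
  exact (L.restrictScalars ℝ).hasFDerivAt.comp_hasDerivAt t h1

end Compress

/-! ### The semigroup and its generator on the range of a commuting projection. -/

section Parts

variable {E : Type*} [NormedAddCommGroup E] [NormedSpace ℂ E]
  {A : E →ₗ.[ℂ] E} {U : ℝ → E →L[ℂ] E} {P : E →L[ℂ] E}

theorem isC0Semigroup_compress (hU : IsC0Semigroup U) (hP : P * P = P)
    (hc : ∀ t, 0 ≤ t → Commute (U t) P) : IsC0Semigroup fun t => compress P (U t) := by
  refine ⟨?_, fun s t hs ht => ?_, fun x => ?_⟩
  · ext y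
    rw [coe_compress hP (hc 0 le_rfl), hU.1]
    rfl
  · ext y
    rw [mul_apply_eq_comp, coe_compress hP (hc _ (add_nonneg hs ht)), coe_compress hP (hc _ hs),
      coe_compress hP (hc _ ht), hU.2.1 s t hs ht]
    rfl
  · rw [Topology.IsInducing.subtypeVal.continuousOn_iff]
    exact (hU.2.2 x).congr fun t ht => coe_compress hP (hc t ht) x

theorem isGenerator_compress (hA : IsGenerator U A) (hP : P * P = P)
    (hc : ∀ t, 0 ≤ t → Commute (U t) P) :
    IsGenerator (fun t => compress P (U t)) (part A P) := by
  intro x y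
  have hcoe : ∀ h : ℝ, 0 < h →
      ((h⁻¹ • (compress P (U h) x - x) : ran P) : E) = h⁻¹ • (U h x - x) := fun h hh => by
    rw [← coe_compress hP (hc h hh.le)]; rfl
  have hev : (fun h : ℝ => ((h⁻¹ • (compress P (U h) x - x) : ran P) : E)) =ᶠ[𝓝[>] 0]
      fun h => h⁻¹ • (U h x - x) := by
    filter_upwards [self_mem_nhdsWithin] with h hh using hcoe h hh
  rw [tendsto_subtype_rng, tendsto_congr' hev, ← hA, LinearPMap.mem_graph_iff,
    LinearPMap.mem_graph_iff]
  -- The difference quotients are fixed by P, and so is their limit Ax.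
  have key : ∀ hx : (x : E) ∈ A.domain, P (A ⟨x, hx⟩) = A ⟨x, hx⟩ := by
    intro hx
    have h1 := hA.tendsto ⟨x, hx⟩
    have h2 := (P.continuous.tendsto _).comp h1
    refine tendsto_nhds_unique h2 (h1.congr' ?_)
    filter_upwards [self_mem_nhdsWithin] with h hh
    rw [Function.comp_apply, ← hcoe h hh]
    exact ((mem_ran_iff hP).1 (h⁻¹ • (compress P (U h) x - x) : ran P).2).symm
  constructor
  · rintro ⟨x', h1, h2⟩
    obtain ⟨x', hx'⟩ := x'
    dsimp only at h1 h2
    subst h1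
    exact ⟨⟨x', hx'⟩, rfl, by rw [← h2]; exact (key hx').symm⟩
  · rintro ⟨⟨x', hx'⟩, h1, h2⟩
    dsimp only at h1 h2
    subst h1
    exact ⟨⟨x, hx'⟩, rfl, Subtype.ext ((key hx').trans h2)⟩

end Parts

/-! ### The dichotomy -/

section Dichotomy

variable {E : Type*} [NormedAddCommGroup E] [NormedSpace ℂ E] [CompleteSpace E]
  {A : E →ₗ.[ℂ] E} {U : ℝ → E →L[ℂ] E} {c : ℂ} {r : ℝ}

theorem commute_semigroup_riesz (hU : IsC0Semigroup U) (hA : IsGenerator U A) (hr : 0 ≤ r)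
    (hs : Metric.sphere c r ⊆ resolventSet A) {t : ℝ} (ht : 0 ≤ t) :
    Commute (U t) (riesz A c r) :=
  commute_dunford hr hs continuousOn_const fun _ hz => hA.commute_resolvent hU ht (hs hz)

/-- The factor I - P on the right of `complResolvent` gives invariance under T(0) = I - P by
commutation alone, also inside the disc. -/
theorem isResolventFamily_left (hU : IsC0Semigroup U) (hA : IsGenerator U A) (hr : 0 < r)
    (hs : Metric.sphere c r ⊆ resolventSet A)
    (hright : ∀ z : ℂ, 0 < z.re → z ∈ resolventSet A ∪ Metric.ball c r) :
    IsResolventFamily (fun t => U t * (1 - riesz A c r))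
      (fun z => complResolvent A c r z * (1 - riesz A c r)) := by
  set Q := 1 - riesz A c r with hQdef
  have hQ : Q * Q = Q := (show IsIdempotentElem _ from riesz_mul_self hr hs).one_sub
  have hUQ : ∀ t, 0 ≤ t → Commute (U t) Q := fun t ht =>
    (Commute.one_right _).sub_right (commute_semigroup_riesz hU hA hr.le hs ht)
  have hQF : ∀ z : ℂ, 0 < z.re → Q * (complResolvent A c r z * Q) = complResolvent A c r z * Q := by
    intro z hz
    have h1 : Commute Q (complResolvent A c r z) :=
      (Commute.one_left _).sub_left (commute_complResolvent hr.le hs (hright z hz)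
        fun w hw => commute_riesz_resolvent hr.le hs hw)
    rw [← mul_assoc, h1.eq, mul_assoc, hQ]
  refine ⟨fun s t hs' ht => ?_, fun x => hU.2.2 (Q x), fun z hz => ?_, fun z y hz => ?_⟩
  · rw [hU.2.1 s t hs' ht, mul_assoc, mul_assoc, ← mul_assoc Q, ← (hUQ t ht).eq, mul_assoc, hQ]
  · rw [hU.1, one_mul, hQF z hz]
  · obtain ⟨hx, e⟩ := exists_apply_complResolvent hr.le hs (hright z hz) (Q y)
    have h1 := hA.hasDerivWithinAt hU ⟨_, hx⟩
    rw [e] at h1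
    have h2 : ∀ h, (U h * Q) ((complResolvent A c r z * Q) y) =
        U h (complResolvent A c r z (Q y)) := fun h => by
      rw [mul_apply_eq_comp, ← mul_apply_eq_comp Q, hQF z hz]; rfl
    have h3 : Q (Q y) = Q y := DFunLike.congr_fun hQ y
    simp only [h2, hU.1, one_mul]
    rw [← hQdef, h3] at h1
    exact h1

/-- The part of `A` in the range of the Riesz projection, as a bounded operator. -/
noncomputable def rieszPart (A : E →ₗ.[ℂ] E) (c : ℂ) (r : ℝ) :
    ran (riesz A c r) →L[ℂ] ran (riesz A c r) :=
  compress (riesz A c r) (dunford A c r fun z => z)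

theorem coe_rieszPart (hr : 0 < r) (hs : Metric.sphere c r ⊆ resolventSet A)
    (y : ran (riesz A c r)) : (rieszPart A c r y : E) = dunford A c r (fun z => z) y :=
  coe_compress (riesz_mul_self hr hs) (commute_dunford hr.le hs continuousOn_id
    fun _ hz => commute_riesz_resolvent hr.le hs (hs hz)).symm y

theorem exists_apply_ran_riesz (hr : 0 < r) (hs : Metric.sphere c r ⊆ resolventSet A)
    (y : ran (riesz A c r)) :
    ∃ hy : (y : E) ∈ A.domain, A ⟨y, hy⟩ = rieszPart A c r y := by
  obtain ⟨hy, e⟩ := exists_apply_dunford_one hr.le hs (y : E)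
  have h1 : riesz A c r y = y := (mem_ran_iff (riesz_mul_self hr hs)).1 y.2
  have h2 : (y : E) ∈ A.domain := h1 ▸ hy
  refine ⟨h2, ?_⟩
  rw [coe_rieszPart hr hs, ← e]
  congr 1
  exact Subtype.ext h1.symm

theorem part_riesz (hr : 0 < r) (hs : Metric.sphere c r ⊆ resolventSet A) :
    part A (riesz A c r) = (rieszPart A c r :
      ran (riesz A c r) →ₗ[ℂ] ran (riesz A c r)).toPMap ⊤ := by
  refine LinearPMap.ext ?_ ?_
  · ext y
    exact ⟨fun _ => trivial, fun _ => (exists_apply_ran_riesz hr hs y).1⟩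
  · intro y hy hy'
    obtain ⟨hy1, e⟩ := exists_apply_ran_riesz hr hs y
    refine Subtype.ext ?_
    have h1 : ((part A (riesz A c r) ⟨y, hy⟩ : ran (riesz A c r)) : E) =
        riesz A c r (A ⟨y, hy1⟩) := rfl
    rw [h1, e]
    exact (mem_ran_iff (riesz_mul_self hr hs)).1 (rieszPart A c r y).2

/-- On ran P both orbits solve u' = Bu, where B = (2πi)⁻¹ ∮ z (zI - A)⁻¹ dz is bounded on the whole
space and commutes with U; uniqueness for Lipschitz equations applies. -/
theorem apply_eq_ranExp (hU : IsC0Semigroup U) (hA : IsGenerator U A) (hr : 0 < r)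
    (hs : Metric.sphere c r ⊆ resolventSet A) {t : ℝ} (ht : 0 ≤ t) (y : ran (riesz A c r)) :
    U t y = ranExp (riesz A c r) (rieszPart A c r) t y := by
  have hP := riesz_mul_self hr hs
  have : CompleteSpace (ran (riesz A c r)) := (isClosed_ran hP).completeSpace_coe
  set B := dunford A c r fun z => z with hB
  obtain ⟨hy, e⟩ := exists_apply_ran_riesz hr hs y
  have hd : ∀ s x, HasDerivAt (fun s => ranExp (riesz A c r) (rieszPart A c r) s x)
      (B (ranExp (riesz A c r) (rieszPart A c r) s x)) s := fun s x => by
    rw [ranExp_apply, hB, ← coe_rieszPart hr hs]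
    exact hasDerivAt_ranExp s x
  refine ODE_solution_unique (v := fun _ x => B x) (K := ‖B‖₊) (a := 0) (b := t)
    (fun _ => B.lipschitz) ((hU.2.2 y).mono Icc_subset_Ici_self) (fun s hs' => ?_)
    (fun s _ => (hd s y).continuousAt.continuousWithinAt)
    (fun s _ => (hd s y).hasDerivWithinAt) ?_ ⟨ht, le_rfl⟩
  · refine (hasDerivWithinAt_orbit hU.2.1 (hA.hasDerivWithinAt hU ⟨y, hy⟩) hs'.1).congr_deriv ?_
    have h1 : Commute (U s) B := commute_dunford hr.le hs continuousOn_id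
      fun z hz => hA.commute_resolvent hU hs'.1 (hs hz)
    rw [e, coe_rieszPart hr hs]
    exact DFunLike.congr_fun h1.eq (y : E)
  · simp only [hU.1, ranExp_zero]
    exact ((mem_ran_iff hP).1 y.2).symm

/-- The reversed group e^{-tA₊}P has generator -A₊ on ran P. As -z lies outside the circle, the
integral S of (w - (-z))⁻¹(wI - A)⁻¹ satisfies (zI + A)S = P, so it inverts zI + A₊ there. -/
theorem isResolventFamily_right (hr : 0 < r) (hs : Metric.sphere c r ⊆ resolventSet A)
    (hleft : ∀ z : ℂ, z.re ≤ 0 → z ∉ Metric.closedBall c r) :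
    IsResolventFamily (fun t => ranExp (riesz A c r) (rieszPart A c r) (-t))
      (fun z => dunford A c r (fun w => (w - -z)⁻¹) * riesz A c r) := by
  set P := riesz A c r with hPdef
  have hP : P * P = P := riesz_mul_self hr hs
  have : CompleteSpace (ran P) := (isClosed_ran hP).completeSpace_coe
  have hout : ∀ z : ℂ, 0 < z.re → -z ∉ Metric.closedBall c r := fun z hz =>
    hleft _ (by simpa using hz.le)
  have hsph : ∀ z : ℂ, 0 < z.re → -z ∉ Metric.sphere c r := fun z hz h =>
    hout z hz (Metric.sphere_subset_closedBall h)
  have hPS : ∀ z : ℂ, 0 < z.re → P * (dunford A c r (fun w => (w - -z)⁻¹) * P) =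
      dunford A c r (fun w => (w - -z)⁻¹) * P := by
    intro z hz
    have h1 : Commute P (dunford A c r fun w => (w - -z)⁻¹) :=
      commute_dunford hr.le hs (continuousOn_sub_inv (hsph z hz))
        fun w hw => commute_riesz_resolvent hr.le hs (hs hw)
    rw [← mul_assoc, h1.eq, mul_assoc, hP]
  refine ⟨fun s t _ _ => ?_, fun x => ?_, fun z hz => ?_, fun z y hz => ?_⟩
  · rw [neg_add, ranExp_add hP]
  · exact Continuous.continuousOn
      ((continuous_iff_continuousAt.2 fun t => (hasDerivAt_ranExp t x).continuousAt).comp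
        continuous_neg)
  · ext y
    rw [neg_zero, mul_apply_eq_comp, ranExp_zero, ← mul_apply_eq_comp P, hPS z hz]
  · obtain ⟨hx, e⟩ := exists_apply_dunford_inv hr.le hs (hsph z hz) (P y)
    set S := dunford A c r fun w => (w - -z)⁻¹ with hS
    have hmem : S (P y) ∈ ran P := (mem_ran_iff hP).2 (DFunLike.congr_fun (hPS z hz) y)
    have hPP : dunford A c r (fun _ => 1) (P y) = P y := DFunLike.congr_fun hP y
    obtain ⟨hx', e'⟩ := exists_apply_ran_riesz hr hs ⟨_, hmem⟩
    rw [circleMean_inv_of_notMem_closedBall hr.le (hout z hz), zero_smul, zero_sub, e',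
      hPP, neg_smul] at e
    have h0 : HasDerivAt (fun h : ℝ => -h) (-1) 0 := hasDerivAt_neg 0
    have h1 := (hasDerivAt_ranExp (B := rieszPart A c r) (-0) (S (P y))).scomp (0 : ℝ) h0
    refine h1.hasDerivWithinAt.congr_deriv ?_
    have h2 : toRan P (S (P y)) = ⟨S (P y), hmem⟩ := toRan_coe hP ⟨_, hmem⟩
    rw [neg_zero, opExp_zero, one_apply_eq_self, h2, ranExp_zero, mul_apply_eq_comp]
    have h3 : ∀ a b p : E, -a - b = -p → (-1 : ℝ) • b = a - p := fun a b p h => by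
      rw [neg_smul, one_smul, neg_eq_iff_eq_neg.1 h.symm]; abel
    exact h3 _ _ _ e

theorem bijOn_ran_riesz (hU : IsC0Semigroup U) (hA : IsGenerator U A) (hr : 0 < r)
    (hs : Metric.sphere c r ⊆ resolventSet A) {t : ℝ} (ht : 0 ≤ t) :
    BijOn (U t) (ran (riesz A c r) : Set E) (ran (riesz A c r) : Set E) := by
  have hP := riesz_mul_self hr hs
  have : CompleteSpace (ran (riesz A c r)) := (isClosed_ran hP).completeSpace_coe
  have hV : ∀ s t : ℝ, s + t = 0 → ∀ y ∈ ran (riesz A c r),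
      ranExp (riesz A c r) (rieszPart A c r) s
        (ranExp (riesz A c r) (rieszPart A c r) t y) = y := fun s t h y hy => by
    rw [← mul_apply_eq_comp, ← ranExp_add hP, h, ranExp_zero, (mem_ran_iff hP).1 hy]
  have hVm : ∀ s x, ranExp (riesz A c r) (rieszPart A c r) s x ∈ ran (riesz A c r) :=
    fun s x => (opExp (rieszPart A c r) s (toRan _ x)).2
  refine InvOn.bijOn (f' := ranExp (riesz A c r) (rieszPart A c r) (-t))
    ⟨fun y hy => ?_, fun y hy => ?_⟩ (fun y hy => ?_) (fun y _ => hVm _ y)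
  · rw [apply_eq_ranExp hU hA hr hs ht ⟨y, hy⟩]
    exact hV _ _ (neg_add_cancel t) y hy
  · rw [apply_eq_ranExp hU hA hr hs ht ⟨_, hVm (-t) y⟩]
    exact hV _ _ (add_neg_cancel t) y hy
  · rw [apply_eq_ranExp hU hA hr hs ht ⟨y, hy⟩]
    exact hVm t y

theorem backward_eq_ranExp (hU : IsC0Semigroup U) (hA : IsGenerator U A) (hr : 0 < r)
    (hs : Metric.sphere c r ⊆ resolventSet A) {t : ℝ} (ht : t < 0) (x : E) :
    backward U (1 - riesz A c r) t x = ranExp (riesz A c r) (rieszPart A c r) t x := by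
  have hP := riesz_mul_self hr hs
  have : CompleteSpace (ran (riesz A c r)) := (isClosed_ran hP).completeSpace_coe
  have ht' : 0 ≤ -t := by linarith
  set y := opExp (rieszPart A c r) t (toRan _ x) with hy
  have h1 : U (-t) y = riesz A c r x := by
    rw [apply_eq_ranExp hU hA hr hs ht' y, hy, ← ranExp_apply, ← mul_apply_eq_comp,
      ← ranExp_add hP, neg_add_cancel, ranExp_zero]
  -- With Px written as U(-t)y for y in ran P, injectivity forces the chosen preimage to be y.
  rw [backward, sub_sub_cancel, ← h1]
  exact (bijOn_ran_riesz hU hA hr hs ht').injOn.leftInvOn_invFunOn y.2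

end Dichotomy

end HyperbolicSectorial

/-! ### Hyperbolicity of the semigroup and its Green function. -/

theorem mainTheorem11 {E : Type*} [NormedAddCommGroup E] [NormedSpace ℂ E] [CompleteSpace E]
    (A : E →ₗ.[ℂ] E) (U : ℝ → E →L[ℂ] E)
    (hU : HyperbolicSectorial.IsC0Semigroup U)
    (hA : HyperbolicSectorial.IsGenerator U A)
    (hs : HyperbolicSectorial.IsHyperbolicSectorial (-A)) :
    ∃ Pplus Pminus : E →L[ℂ] E,
      HyperbolicSectorial.IsSpectralProjection A
        (HyperbolicSectorial.rightSpectrum A) Pplus ∧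
      HyperbolicSectorial.IsSpectralProjection A
        (HyperbolicSectorial.extLeftSpectrum A) Pminus ∧
      Pplus + Pminus = 1 ∧
      -- the semigroup is hyperbolic with projection `P₋`
      HyperbolicSectorial.IsHyperbolicWith U Pminus ∧
      -- `A₊` is bounded and everywhere defined on its space, `A₋` generates the semigroup `T`
      ∃ (Aplus : HyperbolicSectorial.ran Pplus →L[ℂ] HyperbolicSectorial.ran Pplus)
        (T : ℝ → HyperbolicSectorial.ran Pminus →L[ℂ] HyperbolicSectorial.ran Pminus),
        HyperbolicSectorial.part A Pplus =
          (Aplus : HyperbolicSectorial.ran Pplus →ₗ[ℂ]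
            HyperbolicSectorial.ran Pplus).toPMap ⊤ ∧
        HyperbolicSectorial.IsC0Semigroup T ∧
        HyperbolicSectorial.IsGenerator T (HyperbolicSectorial.part A Pminus) ∧
        (∀ t x, 0 ≤ t →
          HyperbolicSectorial.greenFunction U Pminus t x =
            (T t (HyperbolicSectorial.toRan Pminus x) : E)) ∧
        (∀ t x, t < 0 →
          HyperbolicSectorial.greenFunction U Pminus t x =
            -(HyperbolicSectorial.opExp Aplus t (HyperbolicSectorial.toRan Pplus x) : E)) := by
  open HyperbolicSectorial in
  obtain ⟨M, r, hr, hrM, hsph, hin, hout⟩ := hs.exists_circle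
  have hP := riesz_mul_self hr hsph
  have hQ : (1 - riesz A M r) * (1 - riesz A M r) = 1 - riesz A M r :=
    (show IsIdempotentElem _ from hP).one_sub
  have hUQ : ∀ t, 0 ≤ t → Commute (U t) (1 - riesz A M r) := fun t ht =>
    (Commute.one_right _).sub_right (commute_semigroup_riesz hU hA hr.le hsph ht)
  have hK := hs.isCompact_spectrum_inter
  have hin' : ∀ z ∈ HyperbolicSectorial.spectrum A, 0 ≤ z.re → z ∈ Metric.ball (M : ℂ) r :=
    fun z hz h0 => hin z hz (h0.lt_of_ne fun h => hz (hs.mem_resolventSet h.symm))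
  obtain ⟨C₁, hC₁⟩ := exists_norm_complResolvent_le hs.1 hr hsph hin'
  obtain ⟨C₂, -, hC₂⟩ := exists_norm_dunford_inv_le hr.le hrM hsph
  obtain ⟨N₁, ν₁, hN₁, hν₁, h₁⟩ := (isResolventFamily_left hU hA hr hsph
    fun z hz => or_iff_not_imp_left.2 fun h => hin z h hz).exists_norm_le_exp_neg hC₁
  -- Decay of e^{-tA₊}P for t ≥ 0 is the estimate at negative times required of the inverse.
  obtain ⟨N₂, ν₂, hN₂, hν₂, h₂⟩ := (isResolventFamily_right hr hsph hout).exists_norm_le_exp_neg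
    (C := C₂ * ‖riesz A M r‖) fun z hz => (norm_mul_le _ _).trans (by
      rw [mul_div_right_comm]
      exact mul_le_mul_of_nonneg_right (hC₂ z hz) (norm_nonneg _))
  refine ⟨riesz A M r, 1 - riesz A M r,
    isSpectralProjection_riesz hK hr.le hsph hin hout,
    isSpectralProjection_one_sub_riesz hK hr.le hsph hin hout,
    add_sub_cancel _ _,
    ⟨hQ, fun t ht => (hUQ t ht).eq, fun t ht => ?_, max N₁ N₂, min ν₁ ν₂, by positivity,
      by positivity, fun t x ht => ?_, fun t x ht => ?_⟩,
    rieszPart A M r, fun t => compress (1 - riesz A M r) (U t), part_riesz hr hsph,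
    isC0Semigroup_compress hU hQ hUQ, isGenerator_compress hA hQ hUQ, fun t x ht => ?_,
    fun t x ht => ?_⟩
  · rw [sub_sub_cancel]
    exact bijOn_ran_riesz hU hA hr hsph ht
  · refine ContinuousLinearMap.le_of_opNorm_le (U t * (1 - riesz A M r)) ((h₁ t ht).trans ?_) x
    have := min_le_left ν₁ ν₂
    gcongr
    exact le_max_left _ _
  · rw [backward_eq_ranExp hU hA hr hsph ht]
    have h3 := h₂ (-t) (by linarith)
    rw [neg_neg, neg_mul_neg] at h3
    refine ContinuousLinearMap.le_of_opNorm_le _ (h3.trans ?_) x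
    have h4 := mul_le_mul_of_nonpos_right (min_le_right ν₁ ν₂) ht.le
    gcongr
    exact le_max_right _ _
  · rw [greenFunction, if_pos ht, coe_compress hQ (hUQ t ht)]
    rfl
  · rw [greenFunction, if_neg ht.not_ge, backward_eq_ranExp hU hA hr hsph ht, ranExp_apply]
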